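/- Let $|\alpha|\le 1$ and $P>0$. Consider the additive Gaussian noise channel $Y_i=X_i+Z_i$, $i=1,2,\dots$, with noiseless causal feedback, where $Z_i=\alpha U_{i-1}+U_i$ and $U_0,U_1,\dots$ are i.i.d. $N(0,1)$. For $R\in\mathbb{R}$, a $(2^{nR},n)$ feedback code has a message set of size $M=\lceil 2^{nR}\rceil$, measurable encoding functions $X_i(w,y^{i-1})$, $i=1,\dots,n$, and a measurable decoder $\hat W_n:\mathbb{R}^n\to\{1,\dots,M\}$. Its message $W$ is uniform on $\{1,\dots,M\}$ and independent of $(U_i)$, it is required to satisfy $\sum_{i=1}^n E\,X_i^2(W,Y^{i-1})\le nP$, and its error probability is $P_e^{(n)}=\Pr\{\hat W_n(Y^n)\ne W\}$. A real sequence $(C_n)_{n\ge1}$ is called an $n$-block feedback capacity sequence if for every $\epsilon>0$ there is a sequence of $(2^{n(C_n-\epsilon)},n)$ codes with $P_e^{(n)}\to0$, and for every $\epsilon>0$ and every sequence of $(2^{n(C_n+\epsilon)},n)$ codes there is $\delta>0$ with $P_e^{(n)}\ge\delta$ for all $n\ge1$. The feedback capacity $C_{\mathrm{FB}}$ is the limit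 of $C_n$. Theorem. The equation $$P\,x^2=(1-x^2)\,(1-|\alpha|x)^2$$ has a unique positive root $x_0$. An $n$-block feedback capacity sequence exists, every such sequence converges, and its limit is $$C_{\mathrm{FB}}=-\log_2 x_0 .$$ -/

import Mathlib

open MeasureTheory ProbabilityTheory Filter Topology
open scoped ENNReal

noncomputable section

namespace GaussianFeedback

/-- A feedback code with `M` messages and block length `n`. Times are numbered from `0`: the
symbol sent at time `i` is a function of the message and of the `i` previous channel outputs. -/
structure FeedbackCode (M n : ℕ) where
  enc : (i : Fin n) → Fin M → (Fin (i : ℕ) → ℝ) → ℝ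
  measurable_enc : ∀ i w, Measurable (enc i w)
  dec : (Fin n → ℝ) → Fin M
  measurable_dec : Measurable dec

namespace FeedbackCode

variable {M n : ℕ}

/-- The channel output at time `i`, when message `w` is sent and the noise is `z`:
`Y_i = X_i(w, Y_0, …, Y_{i-1}) + z_i`. -/
def outputAt (c : FeedbackCode M n) (w : Fin M) (z : Fin n → ℝ) (i : ℕ) (hi : i < n) : ℝ :=
  c.enc ⟨i, hi⟩ w (fun j : Fin i => c.outputAt w z j (j.2.trans hi)) + z ⟨i, hi⟩
termination_by i
decreasing_by exact j.2

/-- The block of channel outputs `Y^n`. -/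
def output (c : FeedbackCode M n) (w : Fin M) (z : Fin n → ℝ) : Fin n → ℝ :=
  fun i => c.outputAt w z i i.2

/-- The channel input `X_i`, as a function of the message and the noise. -/
def input (c : FeedbackCode M n) (w : Fin M) (z : Fin n → ℝ) (i : Fin n) : ℝ :=
  c.enc i w (fun j : Fin (i : ℕ) => c.output w z ⟨j, j.2.trans i.2⟩)

end FeedbackCode

/-- The MA(1) noise block driven by the innovations `u = (U_0, …, U_n)`. The entry of index `i` is
`α U_i + U_{i+1}`. -/
def ma1Noise (α : ℝ) {n : ℕ} (u : Fin (n + 1) → ℝ) : Fin n → ℝ :=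
  fun i => α * u i.castSucc + u i.succ

/-- The joint law of the message `W`, uniform on the `M` messages, and the innovations
`U_0, …, U_n`, i.i.d. standard Gaussian and independent of `W`. -/
def messageInnovationLaw (M n : ℕ) : Measure (Fin M × (Fin (n + 1) → ℝ)) :=
  (uniformOn (Set.univ : Set (Fin M))).prod (Measure.pi fun _ => gaussianReal 0 1)

namespace FeedbackCode

variable {M n : ℕ}

/-- The expected power constraint `∑ E X_i² ≤ n P`. -/
def SatisfiesPower (c : FeedbackCode M n) (α P : ℝ) : Prop :=
  ∑ i : Fin n, ∫⁻ p, ENNReal.ofReal (c.input p.1 (ma1Noise α p.2) i ^ 2)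
    ∂(messageInnovationLaw M n) ≤ ENNReal.ofReal (n * P)

/-- The probability of error `Pr {Ŵ(Y^n) ≠ W}`. -/
def errorProb (c : FeedbackCode M n) (α : ℝ) : ℝ :=
  (messageInnovationLaw M n).real {p | c.dec (c.output p.1 (ma1Noise α p.2)) ≠ p.1}

end FeedbackCode

/-- The number `2^{nR}` of messages at rate `R` (in bits), rounded up to an integer. -/
def numMessages (n : ℕ) (R : ℝ) : ℕ := ⌈(2 : ℝ) ^ ((n : ℝ) * R)⌉₊

/-- `C 1, C 2, …` is an `n`-block feedback capacity sequence of the MA(1) channel: for every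
`ε > 0` some codes with `2^{n(C_n-ε)}` messages have vanishing error probability, and all codes
with `2^{n(C_n+ε)}` messages have error probability bounded away from zero. -/
def IsCapacitySequence (α P : ℝ) (C : ℕ → ℝ) : Prop :=
  (∀ ε : ℝ, 0 < ε → ∃ c : (n : ℕ) → FeedbackCode (numMessages n (C n - ε)) n,
    (∀ n, 1 ≤ n → (c n).SatisfiesPower α P) ∧
      Tendsto (fun n => (c n).errorProb α) atTop (𝓝 0)) ∧
  (∀ ε : ℝ, 0 < ε → ∀ c : (n : ℕ) → FeedbackCode (numMessages n (C n + ε)) n,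
    (∀ n, 1 ≤ n → (c n).SatisfiesPower α P) →
      ∃ δ : ℝ, 0 < δ ∧ ∀ n, 1 ≤ n → δ ≤ (c n).errorProb α)

/-- `C` is the feedback capacity (in bits per transmission): `n`-block feedback capacity sequences
exist, and all of them converge to `C`. -/
def IsFeedbackCapacity (α P C : ℝ) : Prop :=
  (∃ S : ℕ → ℝ, IsCapacitySequence α P S) ∧
    ∀ S : ℕ → ℝ, IsCapacitySequence α P S → Tendsto S atTop (𝓝 C)

end GaussianFeedback

end

/-! Converse. Reveal `U_0` to the receiver and predict the noise linearly from the past outputs. The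
residual of the output at time `k` is the fresh innovation `U_{k+1}` plus an orthogonal part of
second moment `v_k`, and the next prediction error has second moment `v_k / (1 + v_k)`. Tilting the
true law so that the residuals become independent Gaussians with these second moments makes the
outputs independent of the message. A Fano-type bound then gives `(1 - P_e) log M ≤ ½ ∑ log (1 +
v_k) + log 2`; only second moments enter, so inputs need not be Gaussian.

It remains to bound `∑ log (1 + v_k)` by the power (`sum_log_le`). A weighted square inequality
(`unpredictedVar_le`) compares `v_k` with `E X_k²` and the current prediction error. Summed over
time, `(1 - |α|x)(v_k - (|α|/x) v_k / (1 + v_k))` totals at most `nP`. The tangent in `log (1 + v)`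
at `1 + v = 1 / x²` (`power_tangent_le`) turns this into `∑ log (1 + v_k) ≤ -2n log x` when `x` is
the root.

Achievability copies the equality case, where the input is `±(1/x - |α|)` times the prediction
error. A linear system with multiplier of modulus `1/x` starts at the message point; feedback turns
the multiplier into one of modulus `x`. The receiver recovers the start up to `x^n` times the final
state, and Chebyshev's inequality gives every rate below `-log₂ x`. Two perturbations make room: `x`
slightly above the root leaves spare power, and a filter coefficient `a` slightly smaller than `α`
keeps the loop stable when `|α| = 1`.

Both halves hold for codes of any size `M`, so they also determine the limit of every capacity
sequence. -/

noncomputable section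

namespace GaussianFeedback

/-! ### Triangular shears of `ℝⁿ` -/

/-- Adding to one coordinate a function of the other coordinates preserves Lebesgue measure. -/
lemma measurePreserving_update_add {n : ℕ} (i : Fin (n + 1)) {g : (Fin (n + 1) → ℝ) → ℝ}
    (hg : Measurable g) (hgi : ∀ u u' : Fin (n + 1) → ℝ, (∀ j, j ≠ i → u j = u' j) → g u = g u') :
    MeasurePreserving (fun u : Fin (n + 1) → ℝ => Function.update u i (u i + g u)) := by
  set e := MeasurableEquiv.piFinSuccAbove (fun _ : Fin (n + 1) => ℝ) i with he
  have hpe : MeasurePreserving e volume (volume.prod volume) :=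
    volume_preserving_piFinSuccAbove (fun _ => ℝ) i
  have hswap : MeasurePreserving (Prod.swap : ℝ × (Fin n → ℝ) → (Fin n → ℝ) × ℝ)
      (volume.prod volume) (volume.prod volume) := Measure.measurePreserving_swap
  have hswap' : MeasurePreserving (Prod.swap : (Fin n → ℝ) × ℝ → ℝ × (Fin n → ℝ))
      (volume.prod volume) (volume.prod volume) := Measure.measurePreserving_swap
  have hm : Measurable fun p : (Fin n → ℝ) × ℝ => g (e.symm (0, p.1)) :=
    hg.comp (e.symm.measurable.comp (measurable_const.prodMk measurable_fst))
  have hskew : MeasurePreserving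
      (fun p : (Fin n → ℝ) × ℝ => (id p.1, p.2 + g (e.symm (0, p.1))))
      (volume.prod volume) (volume.prod volume) := by
    refine (MeasurePreserving.id volume).skew_product
      (g := fun a b => b + g (e.symm (0, a))) (measurable_snd.add hm) ?_
    exact Eventually.of_forall fun a => (measurePreserving_add_right volume _).map_eq
  have hall := (hpe.symm e).comp (hswap'.comp (hskew.comp (hswap.comp hpe)))
  refine (congrArg (fun f => MeasurePreserving f volume volume) (?_ : _ = _)).mpr hall
  funext u j
  have hgu : g (i.insertNth (0 : ℝ) fun k => u (i.succAbove k)) = g u := by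
    refine hgi _ _ fun j hj => ?_
    obtain ⟨k, rfl⟩ := Fin.exists_succAbove_eq hj
    simp
  have hsymm : ∀ (a : ℝ) (b : Fin n → ℝ), e.symm (a, b) = i.insertNth a b := fun _ _ => rfl
  have he1 : (e u).1 = u i := rfl
  have he2 : (e u).2 = fun k => u (i.succAbove k) := rfl
  simp only [Function.comp, Prod.swap, he1, he2, id, hsymm, hgu]
  rcases eq_or_ne j i with rfl | hj
  · simp
  · obtain ⟨k, rfl⟩ := Fin.exists_succAbove_eq hj
    simp [hj]

/-- Adding to every coordinate a function of the preceding ones preserves Lebesgue measure. -/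
lemma measurePreserving_triangular {n : ℕ} {g : Fin (n + 1) → (Fin (n + 1) → ℝ) → ℝ}
    (hg : ∀ i, Measurable (g i))
    (hgi : ∀ i, ∀ u u' : Fin (n + 1) → ℝ, (∀ j, j < i → u j = u' j) → g i u = g i u') :
    MeasurePreserving (fun (u : Fin (n + 1) → ℝ) i => u i + g i u) := by
  have key : ∀ k : ℕ, k ≤ n + 1 → MeasurePreserving
      (fun (u : Fin (n + 1) → ℝ) (i : Fin (n + 1)) =>
        if n + 1 - k ≤ (i : ℕ) then u i + g i u else u i) := by
    intro k
    induction k with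
    | zero =>
      intro _
      have hfun : (fun (u : Fin (n + 1) → ℝ) (i : Fin (n + 1)) =>
          if n + 1 - 0 ≤ (i : ℕ) then u i + g i u else u i) = id := by
        funext u i
        rw [if_neg (by omega)]
        rfl
      rw [hfun]
      exact MeasurePreserving.id _
    | succ k ih =>
      intro hk
      set i₀ : Fin (n + 1) := ⟨n + 1 - (k + 1), by omega⟩ with hi₀
      have hi₀v : (i₀ : ℕ) = n + 1 - (k + 1) := rfl
      have hS := measurePreserving_update_add i₀ (hg i₀)
        (fun u u' h => hgi i₀ u u' fun j hj => h j hj.ne)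
      -- Coordinates are shifted from the last to the first: when `i₀` is treated only later ones
      -- have changed, and `g i₀` does not see them.
      convert hS.comp (ih (by omega)) using 1
      ext u i
      have hlow : ∀ j : Fin (n + 1), j ≤ i₀ → ¬ (n + 1 - k ≤ (j : ℕ)) := by
        intro j hj
        have : (j : ℕ) ≤ i₀ := hj
        omega
      rcases eq_or_ne i i₀ with rfl | hi
      · simp only [Function.comp, Function.update_self, if_neg (hlow _ le_rfl)]
        rw [if_pos hi₀v.ge]
        congr 1
        exact hgi _ _ _ fun j hj => (if_neg (hlow j hj.le)).symm
      · simp only [Function.comp, Function.update_of_ne hi]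
        have hne : (i : ℕ) ≠ i₀ := fun h => hi (Fin.ext h)
        by_cases h : n + 1 - k ≤ (i : ℕ)
        · rw [if_pos h, if_pos (by omega)]
        · rw [if_neg h, if_neg (by omega)]
  convert key (n + 1) le_rfl using 1
  ext u i
  simp

/-! ### Products of Gaussian measures -/

lemma lintegral_prod_coord_eq_prod {n : ℕ} {f : Fin n → ℝ → ℝ≥0∞} (hf : ∀ i, Measurable (f i)) :
    ∫⁻ x : Fin n → ℝ, ∏ i, f i (x i) = ∏ i, ∫⁻ t, f i t := by
  induction n with
  | zero => simp [volume_pi]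
  | succ n ih =>
    have h := (volume_preserving_piFinSuccAbove (fun _ : Fin (n + 1) => ℝ) 0).symm
    rw [← h.lintegral_comp_emb (MeasurableEquiv.measurableEmbedding _)]
    have hrw : ∀ a : ℝ × (Fin n → ℝ),
        ∏ i, f i ((MeasurableEquiv.piFinSuccAbove (fun _ : Fin (n + 1) => ℝ) 0).symm a i)
          = f 0 a.1 * ∏ i : Fin n, f i.succ (a.2 i) := by
      intro a
      rw [Fin.prod_univ_succ]
      rfl
    simp_rw [hrw]
    have hm : Measurable fun b : Fin n → ℝ => ∏ i, f i.succ (b i) :=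
      Finset.measurable_prod _ fun i _ => (hf i.succ).comp (measurable_pi_apply i)
    refine (lintegral_prod_mul (μ := volume) (ν := volume) (hf 0).aemeasurable
      hm.aemeasurable).trans ?_
    rw [ih fun i => hf i.succ, Fin.prod_univ_succ]

lemma pi_gaussianReal_eq_withDensity {n : ℕ} {v : Fin n → NNReal} (hv : ∀ i, v i ≠ 0) :
    Measure.pi (fun i => gaussianReal 0 (v i))
      = volume.withDensity fun x : Fin n → ℝ => ∏ i, gaussianPDF 0 (v i) (x i) := by
  refine Measure.pi_eq fun s hs => ?_
  rw [withDensity_apply _ (MeasurableSet.univ_pi hs), ← lintegral_indicator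
    (MeasurableSet.univ_pi hs)]
  have hrw : ∀ x : Fin n → ℝ, (Set.univ.pi s).indicator
      (fun x : Fin n → ℝ => ∏ i, gaussianPDF 0 (v i) (x i)) x
        = ∏ i, (s i).indicator (gaussianPDF 0 (v i)) (x i) := by
    intro x
    by_cases hx : x ∈ Set.univ.pi s
    · rw [Set.indicator_of_mem hx]
      exact Finset.prod_congr rfl fun i _ => (Set.indicator_of_mem (hx i trivial) _).symm
    · rw [Set.indicator_of_notMem hx]
      obtain ⟨i, hi⟩ : ∃ i, x i ∉ s i := by simpa [Set.mem_pi] using hx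
      exact (Finset.prod_eq_zero (Finset.mem_univ i) (Set.indicator_of_notMem hi _)).symm
  simp_rw [hrw]
  rw [lintegral_prod_coord_eq_prod fun i => (measurable_gaussianPDF 0 (v i)).indicator (hs i)]
  refine Finset.prod_congr rfl fun i _ => ?_
  rw [lintegral_indicator (hs i), gaussianReal_apply 0 (hv i)]

lemma gaussianPDF_mul_exp_eq {v : NNReal} (hv : v ≠ 0) (s t : ℝ) :
    gaussianPDF 0 1 s * ENNReal.ofReal
      (Real.exp (s ^ 2 / 2 - t ^ 2 / (2 * v) - Real.log v / 2)) = gaussianPDF 0 v t := by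
  have hv' : (0 : ℝ) < v := lt_of_le_of_ne v.2 fun h => hv (NNReal.eq h.symm)
  rw [gaussianPDF, gaussianPDF, ← ENNReal.ofReal_mul (gaussianPDFReal_nonneg _ _ _)]
  congr 1
  rw [gaussianPDFReal, gaussianPDFReal]
  have h1 : Real.exp (Real.log v / 2) = √v := by
    rw [Real.sqrt_eq_rpow, Real.rpow_def_of_pos hv']
    ring_nf
  have h2 : s ^ 2 / 2 - t ^ 2 / (2 * v) - Real.log v / 2
      = s ^ 2 / 2 + (-(t - 0) ^ 2 / (2 * v)) + -(Real.log v / 2) := by ring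
  have h3 : Real.exp (-(s - 0) ^ 2 / (2 * ((1 : NNReal) : ℝ))) * Real.exp (s ^ 2 / 2) = 1 := by
    rw [← Real.exp_add, ← Real.exp_zero]
    congr 1
    push_cast
    ring
  rw [h2, Real.exp_add, Real.exp_add, Real.exp_neg, h1,
    Real.sqrt_mul (by positivity : (0 : ℝ) ≤ 2 * Real.pi) (v : ℝ)]
  simp only [NNReal.coe_one, mul_one] at h3 ⊢
  rw [mul_inv]
  linear_combination ((√(2 * Real.pi))⁻¹ * Real.exp (-(t - 0) ^ 2 / (2 * v)) * (√(v : ℝ))⁻¹) * h3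

/-- Change of measure from white noise to independent Gaussian variables of variances `v`,
along a map that preserves Lebesgue measure. -/
lemma lintegral_comp_mul_likelihoodRatio {n : ℕ} {v : Fin n → NNReal} (hv : ∀ i, v i ≠ 0)
    {T : (Fin n → ℝ) → Fin n → ℝ} (hT : MeasurePreserving T) {F : (Fin n → ℝ) → ℝ≥0∞}
    (hF : Measurable F) :
    ∫⁻ u, F (T u) * ENNReal.ofReal (Real.exp
        (∑ i, (u i ^ 2 / 2 - T u i ^ 2 / (2 * v i) - Real.log (v i) / 2)))
        ∂(Measure.pi fun _ => gaussianReal 0 1)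
      = ∫⁻ x, F x ∂(Measure.pi fun i => gaussianReal 0 (v i)) := by
  have hmd : ∀ w : Fin n → NNReal,
      Measurable fun x : Fin n → ℝ => ∏ i, gaussianPDF 0 (w i) (x i) := fun w =>
    Finset.measurable_prod _ fun i _ => (measurable_gaussianPDF 0 (w i)).comp (measurable_pi_apply i)
  have hTi : ∀ i, Measurable fun u => T u i := fun i => (measurable_pi_apply i).comp hT.measurable
  have hFT : Measurable fun u => F (T u) := hF.comp hT.measurable
  have hL : Measurable fun u : Fin n → ℝ => ENNReal.ofReal (Real.exp
        (∑ i, (u i ^ 2 / 2 - T u i ^ 2 / (2 * v i) - Real.log (v i) / 2))) := by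
    fun_prop
  rw [pi_gaussianReal_eq_withDensity (v := fun _ => 1) (fun _ => one_ne_zero),
    pi_gaussianReal_eq_withDensity hv]
  -- The ratio turns the standard Gaussian density at `u` into the target density at `T u`;
  -- invariance of Lebesgue measure under `T` does the rest.
  refine (lintegral_withDensity_eq_lintegral_mul _ (hmd _) (hFT.mul hL)).trans ?_
  rw [lintegral_withDensity_eq_lintegral_mul _ (hmd _) hF,
    ← hT.lintegral_comp ((hmd _).mul hF)]
  refine lintegral_congr fun u => ?_
  simp only [Pi.mul_apply]
  rw [Real.exp_sum, ENNReal.ofReal_prod_of_nonneg fun i _ => (Real.exp_pos _).le,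
    mul_left_comm, ← Finset.prod_mul_distrib, mul_comm]
  congr 1
  exact Finset.prod_congr rfl fun i _ => gaussianPDF_mul_exp_eq (hv i) _ _

/-! ### Channel outputs and inputs -/

namespace FeedbackCode

variable {M n : ℕ}

lemma pos_messages (c : FeedbackCode M n) : 0 < M := (c.dec 0).pos

lemma output_eq_input_add (c : FeedbackCode M n) (w : Fin M) (z : Fin n → ℝ) (i : Fin n) :
    c.output w z i = c.input w z i + z i := by
  rw [output, outputAt]
  rfl

lemma outputAt_congr (c : FeedbackCode M n) (w : Fin M) {z z' : Fin n → ℝ} (i : ℕ) (hi : i < n)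
    (h : ∀ j : Fin n, (j : ℕ) ≤ i → z j = z' j) : c.outputAt w z i hi = c.outputAt w z' i hi := by
  induction i using Nat.strong_induction_on with
  | _ i ih =>
    rw [outputAt, outputAt, h ⟨i, hi⟩ le_rfl]
    congr 2
    funext j
    exact ih j j.2 _ fun k hk => h k (hk.trans j.2.le)

lemma input_congr (c : FeedbackCode M n) (w : Fin M) {z z' : Fin n → ℝ} (i : Fin n)
    (h : ∀ j : Fin n, j < i → z j = z' j) : c.input w z i = c.input w z' i := by
  rw [input, input]
  congr 1
  funext j
  exact c.outputAt_congr w j _ fun k hk => h k (Fin.lt_def.2 (hk.trans_lt j.2))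

lemma measurable_outputAt (c : FeedbackCode M n) (w : Fin M) (i : ℕ) (hi : i < n) :
    Measurable fun z => c.outputAt w z i hi := by
  induction i using Nat.strong_induction_on with
  | _ i ih =>
    have h : (fun z => c.outputAt w z i hi) = fun z =>
        c.enc ⟨i, hi⟩ w (fun j : Fin i => c.outputAt w z j (j.2.trans hi)) + z ⟨i, hi⟩ := by
      funext z
      rw [outputAt]
    rw [h]
    exact ((c.measurable_enc ⟨i, hi⟩ w).comp (measurable_pi_iff.2 fun j => ih j j.2 _)).add
      (measurable_pi_apply _)

lemma measurable_output (c : FeedbackCode M n) (w : Fin M) : Measurable (c.output w) :=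
  measurable_pi_iff.2 fun i => c.measurable_outputAt w i i.2

lemma measurable_input (c : FeedbackCode M n) (w : Fin M) (i : Fin n) :
    Measurable fun z => c.input w z i :=
  (c.measurable_enc i w).comp (measurable_pi_iff.2 fun j => c.measurable_outputAt w j _)

end FeedbackCode

lemma measurable_ma1Noise (α : ℝ) (n : ℕ) : Measurable (ma1Noise α (n := n)) := by
  unfold ma1Noise
  fun_prop

lemma FeedbackCode.measurable_input_ma1Noise {M n : ℕ} (c : FeedbackCode M n) (α : ℝ) (i : Fin n) :
    Measurable fun p : Fin M × (Fin (n + 1) → ℝ) => c.input p.1 (ma1Noise α p.2) i :=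
  measurable_from_prod_countable_right fun w =>
    (c.measurable_input w i).comp (measurable_ma1Noise α n)

lemma FeedbackCode.measurable_dec_output {M n : ℕ} (c : FeedbackCode M n) (α : ℝ) :
    Measurable fun p : Fin M × (Fin (n + 1) → ℝ) => c.dec (c.output p.1 (ma1Noise α p.2)) :=
  measurable_from_prod_countable_right fun w =>
    c.measurable_dec.comp ((c.measurable_output w).comp (measurable_ma1Noise α n))

/-! ### The joint law of message and innovations -/

section Law

variable {M n : ℕ}

lemma isProbabilityMeasure_messageInnovationLaw (hM : 0 < M) :
    IsProbabilityMeasure (messageInnovationLaw M n) := by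
  have : Nonempty (Fin M) := ⟨⟨0, hM⟩⟩
  have := isProbabilityMeasure_uniformOn (Set.finite_univ (α := Fin M)) Set.univ_nonempty
  unfold messageInnovationLaw
  infer_instance

lemma lintegral_uniformOn_univ (f : Fin M → ℝ≥0∞) :
    ∫⁻ w, f w ∂(uniformOn (Set.univ : Set (Fin M))) = (M : ℝ≥0∞)⁻¹ * ∑ w, f w := by
  rw [lintegral_fintype, Finset.mul_sum]
  refine Finset.sum_congr rfl fun w _ => ?_
  rw [uniformOn_univ, mul_comm]
  simp [div_eq_mul_inv]

lemma lintegral_messageInnovationLaw {F : Fin M × (Fin (n + 1) → ℝ) → ℝ≥0∞} (hF : Measurable F) :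
    ∫⁻ p, F p ∂(messageInnovationLaw M n)
      = (M : ℝ≥0∞)⁻¹ * ∑ w, ∫⁻ u, F (w, u) ∂(Measure.pi fun _ => gaussianReal 0 1) := by
  rw [messageInnovationLaw, lintegral_prod _ hF.aemeasurable, lintegral_uniformOn_univ]

lemma measurePreserving_innovation (hM : 0 < M) (j : Fin (n + 1)) :
    MeasurePreserving (fun p : Fin M × (Fin (n + 1) → ℝ) => p.2 j) (messageInnovationLaw M n)
      (gaussianReal 0 1) := by
  have : Nonempty (Fin M) := ⟨⟨0, hM⟩⟩
  have := isProbabilityMeasure_uniformOn (Set.finite_univ (α := Fin M)) Set.univ_nonempty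
  exact (measurePreserving_eval (fun _ : Fin (n + 1) => gaussianReal 0 1) j).comp
    measurePreserving_snd

lemma memLp_innovation (hM : 0 < M) (j : Fin (n + 1)) :
    MemLp (fun p : Fin M × (Fin (n + 1) → ℝ) => p.2 j) 2 (messageInnovationLaw M n) :=
  (memLp_id_gaussianReal 2).comp_measurePreserving (measurePreserving_innovation hM j)

lemma integral_innovation_sq (hM : 0 < M) (j : Fin (n + 1)) :
    ∫ p, p.2 j ^ 2 ∂(messageInnovationLaw M n) = 1 := by
  have h := measurePreserving_innovation (n := n) hM j
  have h1 : ∫ t, t ^ 2 ∂(gaussianReal 0 1) = 1 := by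
    have := variance_fun_id_gaussianReal (μ := 0) (v := 1)
    rw [variance_eq_integral aemeasurable_id'] at this
    simpa [integral_id_gaussianReal] using this
  rw [← h1, ← h.map_eq, integral_map h.aemeasurable (by fun_prop)]

/-- A variable that does not depend on the innovation `U_j` is orthogonal to it. -/
lemma integral_mul_innovation_eq_zero (j : Fin (n + 1))
    {f : Fin M × (Fin (n + 1) → ℝ) → ℝ}
    (hf : ∀ w u u', (∀ i, i ≠ j → u i = u' i) → f (w, u) = f (w, u')) :
    ∫ p, f p * p.2 j ∂(messageInnovationLaw M n) = 0 := by
  -- The reflection of `U_j` preserves the law, fixes `f` and flips the sign of the product, so the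
  -- integral is its own negative. No integrability is needed.
  set R : (Fin (n + 1) → ℝ) ≃ᵐ (Fin (n + 1) → ℝ) := MeasurableEquiv.piCongrRight fun i =>
    if i = j then MeasurableEquiv.neg ℝ else MeasurableEquiv.refl ℝ with hR
  have hRi : ∀ u i, R u i = if i = j then - u i else u i := by
    intro u i
    change (if i = j then MeasurableEquiv.neg ℝ else MeasurableEquiv.refl ℝ) (u i) = _
    split_ifs <;> rfl
  have hRp : MeasurePreserving R (Measure.pi fun _ => gaussianReal 0 1)
      (Measure.pi fun _ => gaussianReal 0 1) := by
    refine measurePreserving_pi (fun _ => gaussianReal 0 1) (fun _ => gaussianReal 0 1)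
      fun i => ?_
    by_cases h : i = j
    · simp only [h, if_true]
      refine ⟨measurable_neg, ?_⟩
      have := gaussianReal_map_neg (μ := 0) (v := 1)
      rwa [neg_zero] at this
    · simp only [h, if_false]
      exact MeasurePreserving.id _
  have hp : MeasurePreserving (Prod.map id R) (messageInnovationLaw M n)
      (messageInnovationLaw M n) := (MeasurePreserving.id _).prod hRp
  have he : MeasurableEmbedding (Prod.map (id : Fin M → Fin M) R) :=
    ((MeasurableEquiv.refl (Fin M)).prodCongr R).measurableEmbedding
  have h := hp.integral_comp he fun p : Fin M × (Fin (n + 1) → ℝ) => f p * p.2 j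
  have h2 : ∀ p : Fin M × (Fin (n + 1) → ℝ),
      f (Prod.map id R p) * (Prod.map id R p).2 j = -(f p * p.2 j) := by
    rintro ⟨w, u⟩
    have h3 : f (w, R u) = f (w, u) := hf _ _ _ fun i hi => by rw [hRi, if_neg hi]
    simp only [Prod.map, id, h3, hRi, if_true]
    ring
  simp_rw [h2, integral_neg] at h
  linarith

lemma integral_add_innovation_sq (hM : 0 < M) (j : Fin (n + 1))
    {f : Fin M × (Fin (n + 1) → ℝ) → ℝ} (hfL : MemLp f 2 (messageInnovationLaw M n))
    (hf : ∀ w u u', (∀ i, i ≠ j → u i = u' i) → f (w, u) = f (w, u')) (r s : ℝ) :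
    ∫ p, (r * f p + s * p.2 j) ^ 2 ∂(messageInnovationLaw M n)
      = r ^ 2 * ∫ p, f p ^ 2 ∂(messageInnovationLaw M n) + s ^ 2 := by
  have hU := memLp_innovation (n := n) hM j
  have h1 := (hfL.integrable_sq).const_mul (r ^ 2)
  have h2 := (hU.integrable_sq).const_mul (s ^ 2)
  have h3 : Integrable (fun p => 2 * r * s * (f p * p.2 j)) (messageInnovationLaw M n) :=
    (MemLp.integrable_mul hfL hU).const_mul (2 * r * s)
  have hrw : ∀ p : Fin M × (Fin (n + 1) → ℝ), (r * f p + s * p.2 j) ^ 2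
      = r ^ 2 * f p ^ 2 + s ^ 2 * p.2 j ^ 2 + 2 * r * s * (f p * p.2 j) := fun p => by ring
  simp_rw [hrw]
  refine (integral_add (h1.add h2) h3).trans ?_
  refine (congrArg (· + _) (integral_add h1 h2)).trans ?_
  rw [integral_const_mul, integral_const_mul, integral_const_mul,
    integral_mul_innovation_eq_zero j hf, integral_innovation_sq hM]
  ring

end Law

/-! ### A bound of Fano type -/

/-- If `exp ℓ` is a probability density with respect to `μ` that gives mass `1 / M` to the event
`A`, then `μ A * log M` is at most `-E ℓ + log 2`. -/
lemma measureReal_mul_log_le {Ω : Type*} [MeasurableSpace Ω] {μ : Measure Ω}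
    [IsProbabilityMeasure μ] {A : Set Ω} (hA : MeasurableSet A) {l : Ω → ℝ} (hl : Integrable l μ)
    (hexp : Integrable (fun p => Real.exp (l p)) μ) (h1 : ∫ p, Real.exp (l p) ∂μ = 1)
    {M : ℝ} (hM : 0 < M) (h2 : ∫ p in A, Real.exp (l p) ∂μ = M⁻¹) :
    μ.real A * Real.log M ≤ -∫ p, l p ∂μ + Real.log 2 := by
  have hpt : ∀ p, A.indicator (fun _ => Real.log M) p + l p
      ≤ Real.log 2 - 1 + (2⁻¹ * Real.exp (l p)
        + 2⁻¹ * M * A.indicator (fun p => Real.exp (l p)) p) := by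
    intro p
    -- Tangent of the exponential at `log 2`, used with `y = log M + l` on `A` and `y = l` off `A`.
    -- The upper bound then integrates to `log 2 - 1 + 1/2 + 1/2`.
    have key : ∀ y : ℝ, y ≤ Real.log 2 - 1 + 2⁻¹ * Real.exp y := by
      intro y
      have := Real.add_one_le_exp (y - Real.log 2)
      rw [Real.exp_sub, Real.exp_log two_pos] at this
      linarith
    by_cases hp : p ∈ A
    · rw [Set.indicator_of_mem hp, Set.indicator_of_mem hp]
      have := key (Real.log M + l p)
      rw [Real.exp_add, Real.exp_log hM] at this
      nlinarith [Real.exp_pos (l p)]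
    · rw [Set.indicator_of_notMem hp, Set.indicator_of_notMem hp]
      have := key (l p)
      linarith
  have hi1 : Integrable (A.indicator fun _ => Real.log M) μ := (integrable_const _).indicator hA
  have hi2 : Integrable (fun p => 2⁻¹ * Real.exp (l p)) μ := hexp.const_mul _
  have hi3 : Integrable (fun p => 2⁻¹ * M * A.indicator (fun p => Real.exp (l p)) p) μ :=
    (hexp.indicator hA).const_mul _
  have hi4 : Integrable (fun p => 2⁻¹ * Real.exp (l p)
      + 2⁻¹ * M * A.indicator (fun p => Real.exp (l p)) p) μ := hi2.add hi3
  have h := integral_mono (hi1.add hl) ((integrable_const (Real.log 2 - 1)).add hi4) hpt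
  simp only [Pi.add_apply] at h
  rw [integral_add hi1 hl, integral_add (integrable_const _) hi4,
    integral_indicator_const _ hA, integral_add hi2 hi3, integral_const_mul,
    integral_const_mul, integral_indicator hA, h1, h2,
    integral_const] at h
  have hM' : 2⁻¹ * M * M⁻¹ = 2⁻¹ := by field_simp
  simp only [smul_eq_mul, probReal_univ, one_mul, hM'] at h
  linarith

/-! ### Linear prediction of the innovations from the outputs -/

section Prediction

variable {M n : ℕ}

/-- The innovation `U_k`, extended by zero beyond the block. -/
def innovation (k : ℕ) (p : Fin M × (Fin (n + 1) → ℝ)) : ℝ :=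
  if h : k < n + 1 then p.2 ⟨k, h⟩ else 0

lemma innovation_congr (k : ℕ) (w : Fin M) {u u' : Fin (n + 1) → ℝ}
    (h : ∀ j : Fin (n + 1), (j : ℕ) ≤ k → u j = u' j) :
    innovation k (w, u) = innovation k (w, u') := by
  unfold innovation
  split_ifs with hk
  · exact h _ le_rfl
  · rfl

lemma measurable_innovation (k : ℕ) :
    Measurable (innovation k : Fin M × (Fin (n + 1) → ℝ) → ℝ) := by
  unfold innovation
  split_ifs with h
  · exact (measurable_pi_apply _).comp measurable_snd
  · exact measurable_const

lemma memLp_innovationAt (hM : 0 < M) (k : ℕ) :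
    MemLp (innovation k : Fin M × (Fin (n + 1) → ℝ) → ℝ) 2 (messageInnovationLaw M n) := by
  by_cases h : k < n + 1
  · have : (innovation k : Fin M × (Fin (n + 1) → ℝ) → ℝ) = fun p => p.2 ⟨k, h⟩ := by
      funext p
      simp [innovation, h]
    rw [this]
    exact memLp_innovation hM _
  · have : (innovation k : Fin M × (Fin (n + 1) → ℝ) → ℝ) = fun p => 0 := by
      funext p
      simp [innovation, h]
    rw [this]
    exact MemLp.zero

namespace FeedbackCode

variable (c : FeedbackCode M n) (α : ℝ)

/-- The channel input at time `k`, extended by zero beyond the block. -/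
def inputAt (k : ℕ) (p : Fin M × (Fin (n + 1) → ℝ)) : ℝ :=
  if h : k < n then c.input p.1 (ma1Noise α p.2) ⟨k, h⟩ else 0

/-- The error of the recursive linear prediction of `U_k` from `U_0` and the outputs before
time `k`. -/
def predictionError : ℕ → Fin M × (Fin (n + 1) → ℝ) → ℝ
  | 0 => fun _ => 0
  | k + 1 => fun p => innovation (k + 1) p
      - (1 + ∫ q, (c.inputAt α k q + α * predictionError k q) ^ 2 ∂(messageInnovationLaw M n))⁻¹
        * (c.inputAt α k p + α * predictionError k p + innovation (k + 1) p)

/-- The part of the output at time `k` that is neither predicted nor the new innovation. -/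
def unpredicted (k : ℕ) (p : Fin M × (Fin (n + 1) → ℝ)) : ℝ :=
  c.inputAt α k p + α * c.predictionError α k p

/-- The second moment of the unpredicted part of the output. -/
def unpredictedVar (k : ℕ) : ℝ :=
  ∫ q, c.unpredicted α k q ^ 2 ∂(messageInnovationLaw M n)

lemma unpredictedVar_nonneg (k : ℕ) : 0 ≤ c.unpredictedVar α k :=
  integral_nonneg fun _ => sq_nonneg _

lemma predictionError_succ (k : ℕ) (p : Fin M × (Fin (n + 1) → ℝ)) :
    c.predictionError α (k + 1) p = innovation (k + 1) p
      - (1 + c.unpredictedVar α k)⁻¹ * (c.unpredicted α k p + innovation (k + 1) p) := rfl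

lemma inputAt_congr (k : ℕ) (w : Fin M) {u u' : Fin (n + 1) → ℝ}
    (h : ∀ j : Fin (n + 1), (j : ℕ) ≤ k → u j = u' j) :
    c.inputAt α k (w, u) = c.inputAt α k (w, u') := by
  unfold inputAt
  split_ifs with hk
  · refine c.input_congr w _ fun j hj => ?_
    have hj' : (j : ℕ) < k := hj
    simp only [ma1Noise]
    rw [h j.castSucc (by simpa using hj'.le), h j.succ (by simpa using hj')]
  · rfl

lemma predictionError_congr (k : ℕ) (w : Fin M) {u u' : Fin (n + 1) → ℝ}
    (h : ∀ j : Fin (n + 1), (j : ℕ) ≤ k → u j = u' j) :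
    c.predictionError α k (w, u) = c.predictionError α k (w, u') := by
  induction k with
  | zero => rfl
  | succ k ih =>
    have h' : ∀ j : Fin (n + 1), (j : ℕ) ≤ k → u j = u' j := fun j hj => h j (by omega)
    rw [predictionError_succ, predictionError_succ, unpredicted, unpredicted, ih h',
      c.inputAt_congr α k w h', innovation_congr (k + 1) w h]

lemma unpredicted_congr (k : ℕ) (w : Fin M) {u u' : Fin (n + 1) → ℝ}
    (h : ∀ j : Fin (n + 1), (j : ℕ) ≤ k → u j = u' j) :
    c.unpredicted α k (w, u) = c.unpredicted α k (w, u') := by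
  rw [unpredicted, unpredicted, c.inputAt_congr α k w h, c.predictionError_congr α k w h]

lemma measurable_inputAt (k : ℕ) : Measurable (c.inputAt α k) := by
  unfold inputAt
  split_ifs with h
  · exact c.measurable_input_ma1Noise α _
  · exact measurable_const

lemma measurable_predictionError (k : ℕ) : Measurable (c.predictionError α k) := by
  induction k with
  | zero => exact measurable_const
  | succ k ih =>
    exact (measurable_innovation _).sub (((((c.measurable_inputAt α k).add
      (ih.const_mul α))).add (measurable_innovation _)).const_mul _)

lemma measurable_unpredicted (k : ℕ) : Measurable (c.unpredicted α k) :=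
  (c.measurable_inputAt α k).add ((c.measurable_predictionError α k).const_mul α)

variable {α} {P : ℝ}

lemma SatisfiesPower.integrable_sq {c : FeedbackCode M n} (hc : c.SatisfiesPower α P) (i : Fin n) :
    Integrable (fun p => c.input p.1 (ma1Noise α p.2) i ^ 2) (messageInnovationLaw M n) := by
  refine ⟨((c.measurable_input_ma1Noise α i).pow_const 2).aestronglyMeasurable, ?_⟩
  rw [hasFiniteIntegral_iff_ofReal (Eventually.of_forall fun _ => sq_nonneg _)]
  refine lt_of_le_of_lt ?_ (hc.trans_lt ENNReal.ofReal_lt_top)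
  exact Finset.single_le_sum (f := fun i : Fin n => ∫⁻ p, ENNReal.ofReal
    (c.input p.1 (ma1Noise α p.2) i ^ 2) ∂(messageInnovationLaw M n))
    (fun _ _ => zero_le) (Finset.mem_univ i)

lemma SatisfiesPower.memLp_inputAt {c : FeedbackCode M n} (hc : c.SatisfiesPower α P) (k : ℕ) :
    MemLp (c.inputAt α k) 2 (messageInnovationLaw M n) := by
  rw [memLp_two_iff_integrable_sq (c.measurable_inputAt α k).aestronglyMeasurable]
  by_cases h : k < n
  · simpa [inputAt, h] using hc.integrable_sq ⟨k, h⟩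
  · simp [inputAt, h]

lemma SatisfiesPower.sum_integral_le {c : FeedbackCode M n} (hc : c.SatisfiesPower α P)
    (hP : 0 ≤ P) :
    ∑ k ∈ Finset.range n, ∫ p, c.inputAt α k p ^ 2 ∂(messageInnovationLaw M n) ≤ n * P := by
  rw [Finset.sum_range]
  have h : ∀ i : Fin n, ∫ p, c.inputAt α i p ^ 2 ∂(messageInnovationLaw M n)
      = ∫ p, c.input p.1 (ma1Noise α p.2) i ^ 2 ∂(messageInnovationLaw M n) := by
    intro i
    simp [inputAt]
  simp_rw [h]
  rw [← ENNReal.ofReal_le_ofReal_iff (by positivity), ENNReal.ofReal_sum_of_nonneg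
    fun i _ => integral_nonneg fun _ => sq_nonneg _]
  refine le_trans (le_of_eq (Finset.sum_congr rfl fun i _ => ?_)) hc
  exact ofReal_integral_eq_lintegral_ofReal (hc.integrable_sq i)
    (Eventually.of_forall fun _ => sq_nonneg _)

lemma SatisfiesPower.memLp_predictionError {c : FeedbackCode M n} (hc : c.SatisfiesPower α P)
    (k : ℕ) : MemLp (c.predictionError α k) 2 (messageInnovationLaw M n) := by
  induction k with
  | zero => exact MemLp.zero
  | succ k ih =>
    exact (memLp_innovationAt c.pos_messages _).sub ((((hc.memLp_inputAt k).add
      (ih.const_mul α)).add (memLp_innovationAt c.pos_messages _)).const_mul _)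

lemma SatisfiesPower.memLp_unpredicted {c : FeedbackCode M n} (hc : c.SatisfiesPower α P)
    (k : ℕ) : MemLp (c.unpredicted α k) 2 (messageInnovationLaw M n) :=
  (hc.memLp_inputAt k).add ((hc.memLp_predictionError k).const_mul α)

/-- The unpredicted part at time `k` involves only the message and `U_0, …, U_k`, hence is
orthogonal to the fresh innovation `U_{k+1}`. -/
lemma SatisfiesPower.integral_add_sq {c : FeedbackCode M n} (hc : c.SatisfiesPower α P)
    (k : Fin n) (r s : ℝ) :
    ∫ p, (r * c.unpredicted α k p + s * p.2 k.succ) ^ 2 ∂(messageInnovationLaw M n)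
      = r ^ 2 * c.unpredictedVar α k + s ^ 2 := by
  refine integral_add_innovation_sq c.pos_messages k.succ (hc.memLp_unpredicted k) ?_ r s
  intro w u u' h
  refine c.unpredicted_congr α k w fun j hj => h j fun hjk => ?_
  rw [hjk, Fin.val_succ] at hj
  omega

lemma SatisfiesPower.integral_predictionError_succ {c : FeedbackCode M n}
    (hc : c.SatisfiesPower α P) {k : ℕ} (hk : k < n) :
    ∫ p, c.predictionError α (k + 1) p ^ 2 ∂(messageInnovationLaw M n)
      = c.unpredictedVar α k / (1 + c.unpredictedVar α k) := by
  have hv := c.unpredictedVar_nonneg α k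
  have h := hc.integral_add_sq ⟨k, hk⟩ (-(1 + c.unpredictedVar α k)⁻¹)
    (1 - (1 + c.unpredictedVar α k)⁻¹)
  have hrw : ∀ p : Fin M × (Fin (n + 1) → ℝ), c.predictionError α (k + 1) p ^ 2
      = (-(1 + c.unpredictedVar α k)⁻¹ * c.unpredicted α k p
        + (1 - (1 + c.unpredictedVar α k)⁻¹) * p.2 (Fin.succ ⟨k, hk⟩)) ^ 2 := by
    intro p
    have hi : innovation (k + 1) p = p.2 (Fin.succ ⟨k, hk⟩) := by
      simp [innovation, hk]
    rw [predictionError_succ, hi]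
    ring
  simp_rw [hrw]
  rw [h]
  field_simp
  ring

/-! ### The bound on the accumulated information -/

/-- The difference of the two sides is the integral of `|α|/x · (x X ∓ (1 - |α|x) d)²`, with the
sign of `α`. It vanishes for `X = ±(1/x - |α|) d`, the feedback that the linear code imitates. -/
lemma SatisfiesPower.unpredictedVar_le {c : FeedbackCode M n} (hc : c.SatisfiesPower α P)
    {x : ℝ} (hx : 0 < x) (k : ℕ) :
    (1 - |α| * x) * c.unpredictedVar α k ≤ ∫ p, c.inputAt α k p ^ 2 ∂(messageInnovationLaw M n)
      + (1 - |α| * x) * (|α| / x)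
        * ∫ p, c.predictionError α k p ^ 2 ∂(messageInnovationLaw M n) := by
  rw [unpredictedVar, ← integral_const_mul, ← integral_const_mul,
    ← integral_add (hc.memLp_inputAt k).integrable_sq
      ((hc.memLp_predictionError k).integrable_sq.const_mul _)]
  refine integral_mono ((hc.memLp_unpredicted k).integrable_sq.const_mul _)
    ((hc.memLp_inputAt k).integrable_sq.add
      ((hc.memLp_predictionError k).integrable_sq.const_mul _)) fun p => ?_
  simp only [unpredicted]
  set X := c.inputAt α k p
  set d := c.predictionError α k p
  rw [← sub_nonneg]
  rcases abs_cases α with ⟨h, _⟩ | ⟨h, _⟩ <;> rw [h]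
  · have : X ^ 2 + (1 - α * x) * (α / x) * d ^ 2 - (1 - α * x) * (X + α * d) ^ 2
        = α / x * (x * X - (1 - α * x) * d) ^ 2 := by
      field_simp
      ring
    rw [this]
    positivity
  · have : X ^ 2 + (1 - -α * x) * (-α / x) * d ^ 2 - (1 - -α * x) * (X + α * d) ^ 2
        = -α / x * (x * X + (1 - -α * x) * d) ^ 2 := by
      field_simp
      ring
    rw [this]
    have : 0 ≤ -α := by linarith
    positivity

end FeedbackCode

/-- The tangent inequality for the power needed to reach a given unpredicted variance. -/
lemma power_tangent_le {P β x v : ℝ} (hβ : 0 ≤ β) (hx : 0 < x) (hβx : β * x < 1)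
    (hroot : P * x ^ 2 = (1 - x ^ 2) * (1 - β * x) ^ 2) (hv : 0 ≤ v) :
    P + (1 - β * x) * (1 / x ^ 2 - β * x) * (Real.log (1 + v) + 2 * Real.log x)
      ≤ (1 - β * x) * (v - β / x * (v / (1 + v))) := by
  set F := x ^ 2 * (1 + v) with hF
  have hFpos : 0 < F := by positivity
  have hlog : Real.log (1 + v) + 2 * Real.log x = Real.log F := by
    rw [hF, Real.log_mul (by positivity) (by positivity), Real.log_pow]
    push_cast
    ring
  -- Both logarithm bounds are sharp at `F = 1`, that is at `1 + v = 1 / x²`; the root equation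
  -- makes the constant term there equal to `P`.
  have h1 : Real.log F ≤ F - 1 := Real.log_le_sub_one_of_pos hFpos
  have h2 : -Real.log F ≤ F⁻¹ - 1 := by
    rw [← Real.log_inv]
    exact Real.log_le_sub_one_of_pos (inv_pos.2 hFpos)
  have hP : P = (1 - x ^ 2) * (1 - β * x) ^ 2 / x ^ 2 := by
    field_simp
    linarith
  have hid : (1 - β * x) * (v - β / x * (v / (1 + v))) - P
      = (1 - β * x) * ((F - 1) / x ^ 2 + β * x * (F⁻¹ - 1)) := by
    rw [hP, hF]
    field_simp
    ring
  have h3 : (1 / x ^ 2 - β * x) * Real.log F ≤ (F - 1) / x ^ 2 + β * x * (F⁻¹ - 1) := by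
    have h4 : 1 / x ^ 2 * Real.log F ≤ 1 / x ^ 2 * (F - 1) :=
      mul_le_mul_of_nonneg_left h1 (by positivity)
    have h5 : β * x * -Real.log F ≤ β * x * (F⁻¹ - 1) :=
      mul_le_mul_of_nonneg_left h2 (by positivity)
    have h6 : (F - 1) / x ^ 2 = 1 / x ^ 2 * (F - 1) := by ring
    rw [h6]
    linarith
  have h7 := mul_le_mul_of_nonneg_left h3 (by linarith : (0 : ℝ) ≤ 1 - β * x)
  rw [hlog]
  linarith

lemma FeedbackCode.SatisfiesPower.sum_log_le {α P x : ℝ} {c : FeedbackCode M n}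
    (hc : c.SatisfiesPower α P) (hα : |α| ≤ 1) (hP : 0 ≤ P) (hx : 0 < x) (hx1 : x < 1)
    (hroot : P * x ^ 2 = (1 - x ^ 2) * (1 - |α| * x) ^ 2) :
    ∑ k ∈ Finset.range n, Real.log (1 + c.unpredictedVar α k) ≤ n * (-2 * Real.log x) := by
  have hβ := abs_nonneg α
  have hβx : |α| * x < 1 := by nlinarith
  set B := (1 - |α| * x) * (1 / x ^ 2 - |α| * x) with hB
  have hBpos : 0 < B := by
    have h1 : 1 < 1 / x ^ 2 := by
      rw [lt_div_iff₀ (by positivity)]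
      nlinarith
    exact mul_pos (by linarith) (by linarith)
  have h1 : ∑ k ∈ Finset.range n, (P + B * (Real.log (1 + c.unpredictedVar α k) + 2 * Real.log x))
      ≤ ∑ k ∈ Finset.range n, (1 - |α| * x) * (c.unpredictedVar α k
        - |α| / x * (c.unpredictedVar α k / (1 + c.unpredictedVar α k))) :=
    Finset.sum_le_sum fun k _ => power_tangent_le hβ hx hβx hroot (c.unpredictedVar_nonneg α k)
  have h2 : ∑ k ∈ Finset.range n, (1 - |α| * x) * c.unpredictedVar α k
      ≤ ∑ k ∈ Finset.range n, (∫ p, c.inputAt α k p ^ 2 ∂(messageInnovationLaw M n)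
        + (1 - |α| * x) * (|α| / x)
        * ∫ p, c.predictionError α k p ^ 2 ∂(messageInnovationLaw M n)) :=
    Finset.sum_le_sum fun k _ => hc.unpredictedVar_le hx k
  -- The right side is the same sum shifted by one step. The shift is free: the error at time `0`
  -- vanishes and the one at time `n` is nonnegative.
  have h3 : ∑ k ∈ Finset.range n, ∫ p, c.predictionError α k p ^ 2 ∂(messageInnovationLaw M n)
      ≤ ∑ k ∈ Finset.range n, c.unpredictedVar α k / (1 + c.unpredictedVar α k) := by
    have h4 : ∑ k ∈ Finset.range n, c.unpredictedVar α k / (1 + c.unpredictedVar α k)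
        = ∑ k ∈ Finset.range n,
          ∫ p, c.predictionError α (k + 1) p ^ 2 ∂(messageInnovationLaw M n) :=
      Finset.sum_congr rfl fun k hk =>
        (hc.integral_predictionError_succ (Finset.mem_range.1 hk)).symm
    have h5 := Finset.sum_range_succ
      (fun k => ∫ p, c.predictionError α k p ^ 2 ∂(messageInnovationLaw M n)) n
    have h6 := Finset.sum_range_succ'
      (fun k => ∫ p, c.predictionError α k p ^ 2 ∂(messageInnovationLaw M n)) n
    have h7 : ∫ p, c.predictionError α 0 p ^ 2 ∂(messageInnovationLaw M n) = 0 := by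
      simp [predictionError]
    have h8 : 0 ≤ ∫ p, c.predictionError α n p ^ 2 ∂(messageInnovationLaw M n) :=
      integral_nonneg fun _ => sq_nonneg _
    rw [h4]
    linarith
  have h4 := hc.sum_integral_le hP
  have h5 : 0 ≤ (1 - |α| * x) * (|α| / x) := mul_nonneg (by linarith) (by positivity)
  have h6 := mul_le_mul_of_nonneg_left h3 h5
  simp only [Finset.sum_add_distrib, mul_sub, Finset.sum_sub_distrib, ← mul_assoc,
    ← Finset.mul_sum, Finset.sum_const, Finset.card_range, nsmul_eq_mul, mul_add] at h1 h2 h4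
  have h7 : B * (∑ k ∈ Finset.range n, Real.log (1 + c.unpredictedVar α k)
      - n * (-2 * Real.log x)) ≤ 0 := by
    rw [mul_sub]
    linarith
  have h8 := nonpos_of_mul_nonpos_right h7 hBpos
  linarith

end Prediction

/-! ### The likelihood ratio of the prediction residuals and the converse -/

namespace FeedbackCode

variable {M n : ℕ} (c : FeedbackCode M n) (α : ℝ)

/-- The initial innovation followed by the prediction residuals of the outputs. -/
def residuals (w : Fin M) (u : Fin (n + 1) → ℝ) : Fin (n + 1) → ℝ :=
  fun i => u i + (Fin.cases 0 (fun k : Fin n => c.unpredicted α k (w, u)) i : ℝ)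

lemma residuals_zero (w : Fin M) (u : Fin (n + 1) → ℝ) : c.residuals α w u 0 = u 0 := by
  simp [residuals]

lemma residuals_succ (w : Fin M) (u : Fin (n + 1) → ℝ) (k : Fin n) :
    c.residuals α w u k.succ = u k.succ + c.unpredicted α k (w, u) := by
  simp [residuals]

lemma measurePreserving_residuals (w : Fin M) : MeasurePreserving (c.residuals α w) := by
  refine measurePreserving_triangular (g := fun i u =>
    Fin.cases 0 (fun k : Fin n => c.unpredicted α k (w, u)) i) (fun i => ?_) fun i u u' h => ?_
  · cases i using Fin.cases with
    | zero => exact measurable_const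
    | succ k => exact (c.measurable_unpredicted α k).comp (measurable_const.prodMk measurable_id)
  · cases i using Fin.cases with
    | zero => rfl
    | succ k =>
      refine c.unpredicted_congr α k w fun j hj => h j (Fin.lt_def.2 ?_)
      rw [Fin.val_succ]
      omega

/-- The gain of the predictor of `U_k` applied to the residual of index `k`. -/
def predictorGain : ℕ → ℝ
  | 0 => 1
  | k + 1 => (1 + c.unpredictedVar α k)⁻¹

/-- The outputs, recovered from the residuals. -/
def outputOfResiduals (e : Fin (n + 1) → ℝ) : Fin n → ℝ :=
  fun k => e k.succ + α * (c.predictorGain α k * e k.castSucc)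

lemma measurable_outputOfResiduals : Measurable (c.outputOfResiduals α) := by
  unfold outputOfResiduals
  fun_prop

/-- The predicted part of `U_i` is a multiple of the residual of the same index. At index `0` the
gain is `1` and the error `0`, since `U_0` is treated as known. -/
lemma innovation_eq_predictionError_add (w : Fin M) (u : Fin (n + 1) → ℝ) (i : Fin (n + 1)) :
    u i = c.predictionError α i (w, u) + c.predictorGain α i * c.residuals α w u i := by
  cases i using Fin.cases with
  | zero => simp [predictionError, predictorGain, residuals_zero]
  | succ k =>
    have hi : innovation (k + 1) (w, u) = u k.succ := by simp [innovation, Fin.succ]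
    rw [residuals_succ, Fin.val_succ, predictionError_succ, predictorGain, hi]
    ring

/-- The message does not enter the map from residuals to outputs. Once the residuals are independent
of the message, so is everything the decoder sees. -/
lemma outputOfResiduals_residuals (w : Fin M) (u : Fin (n + 1) → ℝ) :
    c.outputOfResiduals α (c.residuals α w u) = c.output w (ma1Noise α u) := by
  funext k
  have h := c.innovation_eq_predictionError_add α w u k.castSucc
  have hin : c.inputAt α k (w, u) = c.input w (ma1Noise α u) k := by simp [inputAt]
  rw [output_eq_input_add, outputOfResiduals, residuals_succ, unpredicted, hin]
  simp only [ma1Noise, Fin.val_castSucc] at h ⊢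
  linear_combination (-α) * h

/-- The variances of the residuals. -/
def residualVar : Fin (n + 1) → NNReal :=
  Fin.cases 1 fun k => 1 + ⟨c.unpredictedVar α k, c.unpredictedVar_nonneg α k⟩

lemma residualVar_ne_zero (i : Fin (n + 1)) : c.residualVar α i ≠ 0 := by
  cases i using Fin.cases with
  | zero => exact one_ne_zero
  | succ k => exact (add_pos_of_pos_of_nonneg one_pos (zero_le)).ne'

lemma coe_residualVar_zero : (c.residualVar α 0 : ℝ) = 1 := rfl

lemma coe_residualVar_succ (k : Fin n) :
    (c.residualVar α k.succ : ℝ) = 1 + c.unpredictedVar α k := rfl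

/-- The log-likelihood ratio between independent Gaussian residuals and the true law. -/
def logRatio (p : Fin M × (Fin (n + 1) → ℝ)) : ℝ :=
  ∑ i, (p.2 i ^ 2 / 2 - c.residuals α p.1 p.2 i ^ 2 / (2 * c.residualVar α i)
    - Real.log (c.residualVar α i) / 2)

lemma measurable_residuals (i : Fin (n + 1)) :
    Measurable fun p : Fin M × (Fin (n + 1) → ℝ) => c.residuals α p.1 p.2 i :=
  measurable_from_prod_countable_right fun w =>
    (measurable_pi_apply i).comp (c.measurePreserving_residuals α w).measurable

lemma measurable_logRatio : Measurable (c.logRatio α) := by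
  have := c.measurable_residuals α
  unfold logRatio
  fun_prop

variable {α} {P : ℝ}

lemma SatisfiesPower.memLp_residuals {c : FeedbackCode M n} (hc : c.SatisfiesPower α P)
    (i : Fin (n + 1)) :
    MemLp (fun p => c.residuals α p.1 p.2 i) 2 (messageInnovationLaw M n) := by
  cases i using Fin.cases with
  | zero =>
    simp_rw [residuals_zero]
    exact memLp_innovation c.pos_messages 0
  | succ k =>
    simp_rw [residuals_succ]
    exact (memLp_innovation c.pos_messages k.succ).add (hc.memLp_unpredicted k)

lemma SatisfiesPower.integral_residuals_sq {c : FeedbackCode M n} (hc : c.SatisfiesPower α P)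
    (i : Fin (n + 1)) :
    ∫ p, c.residuals α p.1 p.2 i ^ 2 ∂(messageInnovationLaw M n) = c.residualVar α i := by
  cases i using Fin.cases with
  | zero =>
    simp_rw [residuals_zero]
    exact integral_innovation_sq c.pos_messages 0
  | succ k =>
    have h := hc.integral_add_sq k 1 1
    simp only [one_mul, one_pow] at h
    rw [coe_residualVar_succ, add_comm 1 (c.unpredictedVar α k), ← h]
    refine integral_congr_ae (Eventually.of_forall fun p => ?_)
    simp only [residuals_succ]
    ring

lemma SatisfiesPower.integrable_logRatio_term {c : FeedbackCode M n} (hc : c.SatisfiesPower α P)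
    (i : Fin (n + 1)) :
    Integrable (fun p : Fin M × (Fin (n + 1) → ℝ) =>
      p.2 i ^ 2 / 2 - c.residuals α p.1 p.2 i ^ 2 / (2 * c.residualVar α i)
        - Real.log (c.residualVar α i) / 2) (messageInnovationLaw M n) := by
  have := isProbabilityMeasure_messageInnovationLaw (n := n) c.pos_messages
  exact (((memLp_innovation c.pos_messages i).integrable_sq.div_const _).sub
    ((hc.memLp_residuals i).integrable_sq.div_const _)).sub (integrable_const _)

lemma SatisfiesPower.integrable_logRatio {c : FeedbackCode M n} (hc : c.SatisfiesPower α P) :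
    Integrable (c.logRatio α) (messageInnovationLaw M n) :=
  integrable_finsetSum _ fun i _ => hc.integrable_logRatio_term i

/-- The reference variances are the true second moments of the residuals, so the quadratic terms
cancel in expectation and only the log-variances remain. -/
lemma SatisfiesPower.integral_logRatio {c : FeedbackCode M n} (hc : c.SatisfiesPower α P) :
    ∫ p, c.logRatio α p ∂(messageInnovationLaw M n)
      = -(∑ k ∈ Finset.range n, Real.log (1 + c.unpredictedVar α k)) / 2 := by
  have := isProbabilityMeasure_messageInnovationLaw (n := n) c.pos_messages
  have hterm : ∀ i : Fin (n + 1), ∫ p : Fin M × (Fin (n + 1) → ℝ), (p.2 i ^ 2 / 2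
      - c.residuals α p.1 p.2 i ^ 2 / (2 * c.residualVar α i)
        - Real.log (c.residualVar α i) / 2) ∂(messageInnovationLaw M n)
      = -(Real.log (c.residualVar α i) / 2) := by
    intro i
    have h1 := (memLp_innovation (n := n) c.pos_messages i).integrable_sq.div_const 2
    have h2 := (hc.memLp_residuals i).integrable_sq.div_const (2 * (c.residualVar α i : ℝ))
    have h3 := h1.sub h2
    simp only [Pi.sub_def] at h3
    have hv : (c.residualVar α i : ℝ) ≠ 0 := by
      exact_mod_cast c.residualVar_ne_zero α i
    rw [integral_sub h3 (integrable_const _), integral_sub h1 h2, integral_div, integral_div,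
      integral_innovation_sq c.pos_messages, hc.integral_residuals_sq, integral_const]
    simp only [probReal_univ, one_smul]
    field_simp
    ring
  simp only [logRatio]
  rw [integral_finsetSum _ fun i _ => hc.integrable_logRatio_term i]
  simp_rw [hterm]
  rw [Fin.sum_univ_succ, coe_residualVar_zero, Finset.sum_range]
  simp_rw [coe_residualVar_succ]
  rw [Real.log_one, Finset.sum_neg_distrib, ← Finset.sum_div]
  ring

variable (α)

/-- The event that the message is decoded correctly. -/
def correct : Set (Fin M × (Fin (n + 1) → ℝ)) :=
  {p | c.dec (c.output p.1 (ma1Noise α p.2)) = p.1}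

lemma measurableSet_correct : MeasurableSet (c.correct α) :=
  measurableSet_eq_fun (c.measurable_dec_output α) measurable_fst

lemma lintegral_exp_logRatio :
    ∫⁻ p, ENNReal.ofReal (Real.exp (c.logRatio α p)) ∂(messageInnovationLaw M n) = 1 := by
  have hM : (M : ℝ≥0∞) ≠ 0 := by exact_mod_cast c.pos_messages.ne'
  rw [lintegral_messageInnovationLaw (c.measurable_logRatio α).exp.ennreal_ofReal]
  have h : ∀ w : Fin M, ∫⁻ u, ENNReal.ofReal (Real.exp (c.logRatio α (w, u)))
      ∂(Measure.pi fun _ : Fin (n + 1) => gaussianReal 0 1) = 1 := by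
    intro w
    have := lintegral_comp_mul_likelihoodRatio (c.residualVar_ne_zero α)
      (c.measurePreserving_residuals α w) (F := fun _ => 1) measurable_const
    simpa [logRatio] using this
  simp_rw [h]
  simp [ENNReal.inv_mul_cancel hM (ENNReal.natCast_ne_top M)]

/-- Under the tilted law the residuals have the same distribution for every message, so the decoder
can only guess: its decision regions partition the residual space, and their masses average to `1 /
M`. -/
lemma setLIntegral_exp_logRatio :
    ∫⁻ p in c.correct α, ENNReal.ofReal (Real.exp (c.logRatio α p)) ∂(messageInnovationLaw M n)
      = (M : ℝ≥0∞)⁻¹ := by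
  set D : Fin M → Set (Fin (n + 1) → ℝ) := fun w => {e | c.dec (c.outputOfResiduals α e) = w}
    with hD
  have hdm : Measurable fun e => c.dec (c.outputOfResiduals α e) :=
    c.measurable_dec.comp (c.measurable_outputOfResiduals α)
  have hDm : ∀ w, MeasurableSet (D w) := fun w => hdm (measurableSet_singleton w)
  rw [← lintegral_indicator (c.measurableSet_correct α), lintegral_messageInnovationLaw
    ((c.measurable_logRatio α).exp.ennreal_ofReal.indicator (c.measurableSet_correct α))]
  have h : ∀ w : Fin M, ∫⁻ u, (c.correct α).indicator
      (fun p => ENNReal.ofReal (Real.exp (c.logRatio α p))) (w, u)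
      ∂(Measure.pi fun _ : Fin (n + 1) => gaussianReal 0 1)
        = (Measure.pi fun i => gaussianReal 0 (c.residualVar α i)) (D w) := by
    intro w
    have := lintegral_comp_mul_likelihoodRatio (c.residualVar_ne_zero α)
      (c.measurePreserving_residuals α w) (F := (D w).indicator 1)
      (measurable_one.indicator (hDm w))
    rw [lintegral_indicator_one (hDm w)] at this
    rw [← this]
    refine lintegral_congr fun u => ?_
    by_cases hw : c.dec (c.output w (ma1Noise α u)) = w
    · rw [Set.indicator_of_mem (show (w, u) ∈ c.correct α from hw), Set.indicator_of_mem
        (show c.residuals α w u ∈ D w by simpa [hD, outputOfResiduals_residuals] using hw)]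
      simp [logRatio]
    · rw [Set.indicator_of_notMem (show (w, u) ∉ c.correct α from hw), Set.indicator_of_notMem
        (show c.residuals α w u ∉ D w by simpa [hD, outputOfResiduals_residuals] using hw)]
      simp
  simp_rw [h]
  have hsum : ∑ w, (Measure.pi fun i => gaussianReal 0 (c.residualVar α i)) (D w) = 1 := by
    rw [← measure_biUnion_finset (fun w _ w' _ hww => ?_) fun w _ => hDm w]
    · have hun : ⋃ w ∈ Finset.univ, D w = Set.univ := by
        ext e
        simp [hD]
      rw [hun, measure_univ]
    · exact Set.disjoint_left.2 fun e he he' => hww (he.symm.trans he')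
  rw [hsum, mul_one]

lemma integrable_exp_logRatio :
    Integrable (fun p => Real.exp (c.logRatio α p)) (messageInnovationLaw M n) := by
  refine ⟨(c.measurable_logRatio α).exp.aestronglyMeasurable, ?_⟩
  rw [hasFiniteIntegral_iff_ofReal (Eventually.of_forall fun _ => (Real.exp_pos _).le),
    c.lintegral_exp_logRatio]
  exact ENNReal.one_lt_top

lemma integral_exp_logRatio :
    ∫ p, Real.exp (c.logRatio α p) ∂(messageInnovationLaw M n) = 1 := by
  rw [integral_eq_lintegral_of_nonneg_ae (Eventually.of_forall fun _ => (Real.exp_pos _).le)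
    (c.measurable_logRatio α).exp.aestronglyMeasurable, c.lintegral_exp_logRatio]
  rfl

lemma setIntegral_exp_logRatio :
    ∫ p in c.correct α, Real.exp (c.logRatio α p) ∂(messageInnovationLaw M n) = (M : ℝ)⁻¹ := by
  rw [integral_eq_lintegral_of_nonneg_ae (Eventually.of_forall fun _ => (Real.exp_pos _).le)
    (c.measurable_logRatio α).exp.aestronglyMeasurable, c.setLIntegral_exp_logRatio]
  simp

lemma measureReal_correct :
    (messageInnovationLaw M n).real (c.correct α) = 1 - c.errorProb α := by
  have := isProbabilityMeasure_messageInnovationLaw (n := n) c.pos_messages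
  have h := probReal_compl_eq_one_sub (μ := messageInnovationLaw M n) (c.measurableSet_correct α)
  have h2 : c.errorProb α = (messageInnovationLaw M n).real (c.correct α)ᶜ := rfl
  rw [h2, h]
  ring

lemma errorProb_nonneg : 0 ≤ c.errorProb α := measureReal_nonneg

/-- No code with at least two messages is free of errors. -/
lemma errorProb_pos (hM : 1 < M) : 0 < c.errorProb α := by
  refine lt_of_le_of_ne (c.errorProb_nonneg α) fun h => ?_
  have := isProbabilityMeasure_messageInnovationLaw (n := n) c.pos_messages
  have h0 : messageInnovationLaw M n (c.correct α)ᶜ = 0 := by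
    have h2 : (messageInnovationLaw M n).real (c.correct α)ᶜ = 0 := h.symm
    rwa [measureReal_eq_zero_iff] at h2
  have hae : c.correct α =ᵐ[messageInnovationLaw M n] Set.univ := by
    rwa [ae_eq_univ]
  have h1 := c.setIntegral_exp_logRatio α
  rw [setIntegral_congr_set hae, setIntegral_univ, c.integral_exp_logRatio] at h1
  have hM' : (1 : ℝ) < M := by exact_mod_cast hM
  have := inv_lt_one_of_one_lt₀ hM'
  linarith

variable {α}

lemma SatisfiesPower.one_sub_errorProb_mul_log_le {x : ℝ} {c : FeedbackCode M n}
    (hc : c.SatisfiesPower α P) (hα : |α| ≤ 1) (hP : 0 ≤ P) (hx : 0 < x) (hx1 : x < 1)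
    (hroot : P * x ^ 2 = (1 - x ^ 2) * (1 - |α| * x) ^ 2) :
    (1 - c.errorProb α) * Real.log M ≤ n * (-Real.log x) + Real.log 2 := by
  have := isProbabilityMeasure_messageInnovationLaw (n := n) c.pos_messages
  have h := measureReal_mul_log_le (c.measurableSet_correct α) hc.integrable_logRatio
    (c.integrable_exp_logRatio α) (c.integral_exp_logRatio α)
    (by exact_mod_cast c.pos_messages) (c.setIntegral_exp_logRatio α)
  rw [c.measureReal_correct, hc.integral_logRatio] at h
  have h2 := hc.sum_log_le hα hP hx hx1 hroot
  linarith

end FeedbackCode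

/-- Above the capacity, the error probabilities of long codes are bounded away from zero. -/
lemma exists_errorProb_ge {α P x ε : ℝ} (hα : |α| ≤ 1) (hP : 0 ≤ P) (hx : 0 < x) (hx1 : x < 1)
    (hroot : P * x ^ 2 = (1 - x ^ 2) * (1 - |α| * x) ^ 2) (hε : 0 < ε) :
    ∃ δ : ℝ, 0 < δ ∧ ∃ N : ℕ, ∀ n, N ≤ n → ∀ M : ℕ, ∀ c : FeedbackCode M n,
      c.SatisfiesPower α P → (2 : ℝ) ^ ((n : ℝ) * (-Real.logb 2 x + ε)) ≤ M →
        δ ≤ c.errorProb α := by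
  set L := -Real.log x with hL
  have hLpos : 0 < L := by
    rw [hL, neg_pos]
    exact Real.log_neg hx hx1
  have hlog2 : 0 < Real.log 2 := Real.log_pos one_lt_two
  set E := ε * Real.log 2 with hE
  have hEpos : 0 < E := mul_pos hε hlog2
  obtain ⟨N, hN⟩ := exists_nat_gt (2 * Real.log 2 / E)
  -- This `δ` solves `(1 - δ)(L + E) = L + E / 2`; the surplus `n E / 2` exceeds `log 2` once `n ≥
  -- N`.
  refine ⟨E / (2 * (L + E)), by positivity, N, fun n hn M c hc hM => ?_⟩
  have h := hc.one_sub_errorProb_mul_log_le hα hP hx hx1 hroot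
  have hlogM : n * (L + E) ≤ Real.log M := by
    have h1 := Real.log_le_log (by positivity) hM
    rw [Real.log_rpow two_pos] at h1
    have h2 : Real.logb 2 x * Real.log 2 = Real.log x := by
      rw [Real.logb]
      field_simp
    have h3 : n * (L + E) = n * (-Real.logb 2 x + ε) * Real.log 2 := by
      rw [hL, hE, ← h2]
      ring
    rwa [h3]
  have hn' : 2 * Real.log 2 / E < n := hN.trans_le (by exact_mod_cast hn)
  have hnpos : (0 : ℝ) < n := lt_of_le_of_lt (by positivity) hn'
  rw [div_lt_iff₀ hEpos] at hn'
  by_contra hlt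
  push Not at hlt
  have hsmall : E / (2 * (L + E)) < 1 := by
    rw [div_lt_one (by positivity)]
    linarith
  have h5 : (1 - E / (2 * (L + E))) * (n * (L + E)) = n * L + n * E / 2 := by
    field_simp
    ring
  have h6 : (1 - E / (2 * (L + E))) * (n * (L + E)) < (1 - c.errorProb α) * Real.log M :=
    lt_of_lt_of_le (mul_lt_mul_of_pos_right (by linarith) (by positivity))
      (mul_le_mul_of_nonneg_left hlogM (by linarith))
  linarith

/-! ### A linear feedback code -/

/-- A finite block of reals, extended by zero to a sequence. -/
def extendZero {m : ℕ} (y : Fin m → ℝ) (j : ℕ) : ℝ := if h : j < m then y ⟨j, h⟩ else 0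

/-- The autoregressive filter `e_k = y_k - r e_{k-1}`. -/
def arFilter (r : ℝ) (y : ℕ → ℝ) : ℕ → ℝ
  | 0 => y 0
  | k + 1 => y (k + 1) - r * arFilter r y k

/-- The state of the linear system `d_{k+1} = l d_k + b e_k` started from `θ` and driven by the
filtered sequence `y`. -/
def linearState (l b r θ : ℝ) (y : ℕ → ℝ) : ℕ → ℝ
  | 0 => θ
  | k + 1 => l * linearState l b r θ y k + b * arFilter r y k

lemma measurable_extendZero {m : ℕ} (j : ℕ) :
    Measurable fun y : Fin m → ℝ => extendZero y j := by
  unfold extendZero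
  split_ifs
  · exact measurable_pi_apply _
  · exact measurable_const

lemma measurable_arFilter {m : ℕ} (r : ℝ) (k : ℕ) :
    Measurable fun y : Fin m → ℝ => arFilter r (extendZero y) k := by
  induction k with
  | zero => exact measurable_extendZero 0
  | succ k ih => exact (measurable_extendZero (k + 1)).sub (ih.const_mul r)

lemma measurable_linearState {m : ℕ} (l b r θ : ℝ) (k : ℕ) :
    Measurable fun y : Fin m → ℝ => linearState l b r θ (extendZero y) k := by
  induction k with
  | zero => exact measurable_const
  | succ k ih => exact (ih.const_mul l).add ((measurable_arFilter r k).const_mul b)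

lemma arFilter_congr (r : ℝ) {y y' : ℕ → ℝ} (k : ℕ) (h : ∀ j ≤ k, y j = y' j) :
    arFilter r y k = arFilter r y' k := by
  induction k with
  | zero => exact h 0 le_rfl
  | succ k ih => rw [arFilter, arFilter, ih fun j hj => h j (by omega), h (k + 1) le_rfl]

lemma linearState_congr (l b r θ : ℝ) {y y' : ℕ → ℝ} (k : ℕ) (h : ∀ j < k, y j = y' j) :
    linearState l b r θ y k = linearState l b r θ y' k := by
  induction k with
  | zero => rfl
  | succ k ih =>
    rw [linearState, linearState, ih fun j hj => h j (by omega),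
      arFilter_congr r k fun j hj => h j (by omega)]

/-- The decoder rests on this splitting: it computes the second summand from the outputs and
estimates `θ` by minus that summand over `l ^ n`. -/
lemma linearState_eq_pow_mul_add (l b r θ : ℝ) (y : ℕ → ℝ) (k : ℕ) :
    linearState l b r θ y k = l ^ k * θ + linearState l b r 0 y k := by
  induction k with
  | zero => simp [linearState]
  | succ k ih =>
    rw [linearState, ih, linearState]
    ring

/-- The message whose point `w / M` is closest to `t`. -/
def nearestMessage {M : ℕ} (hM : 0 < M) (t : ℝ) : Fin M :=
  ⟨min ⌊M * t + 1 / 2⌋₊ (M - 1), by omega⟩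

lemma measurable_nearestMessage {M : ℕ} (hM : 0 < M) : Measurable (nearestMessage hM) := by
  have h1 : Measurable fun t : ℝ => ⌊M * t + 1 / 2⌋₊ := by fun_prop
  exact (measurable_from_top (f := fun k : ℕ => (⟨min k (M - 1), by omega⟩ : Fin M))).comp h1

lemma nearestMessage_eq {M : ℕ} (hM : 0 < M) {t : ℝ} {w : Fin M}
    (h : |M * t - w| < 1 / 2) : nearestMessage hM t = w := by
  rw [abs_lt] at h
  have hfl : ⌊M * t + 1 / 2⌋₊ = (w : ℕ) := by
    rw [Nat.floor_eq_iff]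
    · exact ⟨by linarith, by linarith⟩
    · have : (0 : ℝ) ≤ (w : ℕ) := by positivity
      linarith
  ext
  simp only [nearestMessage, hfl]
  omega

/-- The code that transmits a multiple of the state of a linear system driven by the outputs and
started from the message point `w / M`. -/
def linearCode {M : ℕ} (hM : 0 < M) (n : ℕ) (g l b r : ℝ) : FeedbackCode M n where
  enc i w y := g * linearState l b r ((w : ℝ) / M) (extendZero y) i
  measurable_enc i _ := (measurable_linearState l b r _ i).const_mul g
  dec y := nearestMessage hM (-(linearState l b r 0 (extendZero y) n) / l ^ n)
  measurable_dec := (measurable_nearestMessage hM).comp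
    ((measurable_linearState l b r 0 n).neg.div_const _)

lemma input_linearCode {M : ℕ} (hM : 0 < M) (n : ℕ) (g l b r : ℝ) (w : Fin M) (z : Fin n → ℝ)
    (i : Fin n) : (linearCode hM n g l b r).input w z i
      = g * linearState l b r ((w : ℝ) / M)
        (extendZero ((linearCode hM n g l b r).output w z)) i := by
  refine congrArg (g * ·) (linearState_congr l b r _ _ fun j hj => ?_)
  simp [extendZero, hj, hj.trans i.2]

/-! ### The closed loop -/

section ClosedLoop

variable {M n : ℕ}

/-- The deviation of the encoder's reconstruction of the innovation `U_{k+1}`. -/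
def loopBias (α a : ℝ) : ℕ → Fin M × (Fin (n + 1) → ℝ) → ℝ
  | 0 => fun p => -a * ((p.1 : ℝ) / M) + α * innovation 0 p
  | k + 1 => fun p => -a * loopBias α a k p + (α - a) * innovation (k + 1) p

/-- The state of the linear code as a function of the message and the innovations. -/
def loopState (α a s x : ℝ) : ℕ → Fin M × (Fin (n + 1) → ℝ) → ℝ
  | 0 => fun p => (p.1 : ℝ) / M
  | k + 1 => fun p => -(s * x) * loopState α a s x k p
      + (1 - x ^ 2) * (innovation (k + 1) p + loopBias α a k p)

lemma loopBias_zero (α a : ℝ) (p : Fin M × (Fin (n + 1) → ℝ)) :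
    loopBias α a 0 p = -a * ((p.1 : ℝ) / M) + α * innovation 0 p := rfl

lemma loopBias_succ (α a : ℝ) (k : ℕ) (p : Fin M × (Fin (n + 1) → ℝ)) :
    loopBias α a (k + 1) p = -a * loopBias α a k p + (α - a) * innovation (k + 1) p := rfl

lemma loopState_succ (α a s x : ℝ) (k : ℕ) (p : Fin M × (Fin (n + 1) → ℝ)) :
    loopState α a s x (k + 1) p = -(s * x) * loopState α a s x k p
      + (1 - x ^ 2) * (innovation (k + 1) p + loopBias α a k p) := rfl

/-- The filter is the stationary predictor: `a x²` is `a` times the gain `1 / (1 + v)` at `1 + v = 1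
/ x²`. Its output plus `-(s/x) d_k` is the fresh innovation up to a bias, and substituting this
changes the multiplier `-(s/x)` into `-(s/x) x² = -(s x)`. -/
lemma linearState_output_and_arFilter_output (hM : 0 < M) {α a s x : ℝ} (hx : x ≠ 0)
    (p : Fin M × (Fin (n + 1) → ℝ)) (k : ℕ) (hk : k < n) :
    let c := linearCode hM n (s / x - a) (-(s / x)) (1 - x ^ 2) (a * x ^ 2)
    let Y := extendZero (c.output p.1 (ma1Noise α p.2))
    let d := linearState (-(s / x)) (1 - x ^ 2) (a * x ^ 2) ((p.1 : ℝ) / M) Y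
    d k = loopState α a s x k p ∧
      arFilter (a * x ^ 2) Y k + -(s / x) * d k = innovation (k + 1) p + loopBias α a k p := by
  intro c Y d
  have hY : ∀ j, j < n → Y j = (s / x - a) * d j + α * innovation j p + innovation (j + 1) p := by
    intro j hj
    have h1 : Y j = c.output p.1 (ma1Noise α p.2) ⟨j, hj⟩ := by simp [Y, extendZero, hj]
    have h2 : c.input p.1 (ma1Noise α p.2) ⟨j, hj⟩ = (s / x - a) * d j := input_linearCode ..
    have h3 : innovation j p = p.2 (Fin.castSucc ⟨j, hj⟩) := by
      simp [innovation, Nat.lt_succ_of_lt hj]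
    have h4 : innovation (j + 1) p = p.2 (Fin.succ ⟨j, hj⟩) := by
      simp [innovation, hj]
    rw [h1, c.output_eq_input_add, h2, h3, h4, ma1Noise]
    ring
  induction k with
  | zero =>
    refine ⟨rfl, ?_⟩
    change Y 0 + _ = _
    have hd : d 0 = (p.1 : ℝ) / M := rfl
    rw [hY 0 hk, hd, loopBias_zero]
    ring
  | succ k ih =>
    obtain ⟨ih1, ih2⟩ := ih (by omega)
    have hd : d (k + 1) = -(s / x) * d k + (1 - x ^ 2) * arFilter (a * x ^ 2) Y k := rfl
    have he : arFilter (a * x ^ 2) Y (k + 1)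
        = Y (k + 1) - a * x ^ 2 * arFilter (a * x ^ 2) Y k := rfl
    have hsx : -(s * x) = -(s / x) * x ^ 2 := by
      field_simp
    refine ⟨?_, ?_⟩
    · rw [loopState_succ, ← ih1, ← ih2, hd, hsx]
      ring
    · rw [loopBias_succ, he, hY (k + 1) hk]
      linear_combination (-a) * hd - a * ih2

lemma linearState_output (hM : 0 < M) {α a s x : ℝ} (hx : x ≠ 0)
    (p : Fin M × (Fin (n + 1) → ℝ)) (k : ℕ) (hk : k ≤ n) :
    linearState (-(s / x)) (1 - x ^ 2) (a * x ^ 2) ((p.1 : ℝ) / M)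
      (extendZero ((linearCode hM n (s / x - a) (-(s / x)) (1 - x ^ 2) (a * x ^ 2)).output p.1
        (ma1Noise α p.2))) k = loopState α a s x k p := by
  cases k with
  | zero => rfl
  | succ k =>
    obtain ⟨h1, h2⟩ := linearState_output_and_arFilter_output hM (α := α) (a := a) (s := s) hx p k hk
    have hsx : -(s * x) = -(s / x) * x ^ 2 := by
      field_simp
    rw [loopState_succ, linearState, ← h1, ← h2, hsx]
    ring

lemma loopBias_congr (α a : ℝ) (k : ℕ) (w : Fin M) {u u' : Fin (n + 1) → ℝ}
    (h : ∀ j : Fin (n + 1), (j : ℕ) ≤ k → u j = u' j) :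
    loopBias α a k (w, u) = loopBias α a k (w, u') := by
  induction k with
  | zero => rw [loopBias_zero, loopBias_zero, innovation_congr 0 w h]
  | succ k ih =>
    rw [loopBias_succ, loopBias_succ, ih fun j hj => h j (by omega),
      innovation_congr (k + 1) w h]

lemma loopState_congr (α a s x : ℝ) (k : ℕ) (w : Fin M) {u u' : Fin (n + 1) → ℝ}
    (h : ∀ j : Fin (n + 1), (j : ℕ) ≤ k → u j = u' j) :
    loopState α a s x k (w, u) = loopState α a s x k (w, u') := by
  induction k with
  | zero => rfl
  | succ k ih =>
    rw [loopState_succ, loopState_succ, ih fun j hj => h j (by omega),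
      innovation_congr (k + 1) w h, loopBias_congr α a k w fun j hj => h j (by omega)]

lemma memLp_messagePoint (hM : 0 < M) :
    MemLp (fun p : Fin M × (Fin (n + 1) → ℝ) => (p.1 : ℝ) / M) 2 (messageInnovationLaw M n) := by
  have := isProbabilityMeasure_messageInnovationLaw (n := n) hM
  refine MemLp.of_bound ?_ 1 (Eventually.of_forall fun p => ?_)
  · exact ((measurable_from_top (f := fun w : Fin M => (w : ℝ) / M)).comp
      measurable_fst).aestronglyMeasurable
  · have hM' : (0 : ℝ) < M := by exact_mod_cast hM
    rw [Real.norm_of_nonneg (by positivity), div_le_one hM']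
    exact_mod_cast p.1.2.le

lemma integral_messagePoint_sq_le (hM : 0 < M) :
    ∫ p, ((p.1 : ℝ) / M) ^ 2 ∂(messageInnovationLaw M n) ≤ 1 := by
  have := isProbabilityMeasure_messageInnovationLaw (n := n) hM
  have h := integral_mono (memLp_messagePoint (n := n) hM).integrable_sq
    (integrable_const (1 : ℝ)) fun p => ?_
  · simpa using h
  · have hM' : (0 : ℝ) < M := by exact_mod_cast hM
    refine pow_le_one₀ (by positivity) ?_
    rw [div_le_one hM']
    exact_mod_cast p.1.2.le

lemma memLp_loopBias (hM : 0 < M) (α a : ℝ) (k : ℕ) :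
    MemLp (loopBias α a k) 2 (messageInnovationLaw M n) := by
  induction k with
  | zero =>
    exact ((memLp_messagePoint hM).const_mul _).add
      ((memLp_innovationAt hM 0).const_mul _)
  | succ k ih =>
    exact (ih.const_mul _).add ((memLp_innovationAt hM (k + 1)).const_mul _)

lemma memLp_loopState (hM : 0 < M) (α a s x : ℝ) (k : ℕ) :
    MemLp (loopState α a s x k) 2 (messageInnovationLaw M n) := by
  induction k with
  | zero => exact memLp_messagePoint hM
  | succ k ih =>
    exact (ih.const_mul _).add (((memLp_innovationAt hM (k + 1)).add
      (memLp_loopBias hM α a k)).const_mul _)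

lemma innovation_eq {k : ℕ} (hk : k < n + 1) (p : Fin M × (Fin (n + 1) → ℝ)) :
    innovation k p = p.2 ⟨k, hk⟩ := by
  simp [innovation, hk]

lemma integral_loopBias_zero_le (hM : 0 < M) {α a : ℝ} (hα : |α| ≤ 1) (ha : |a| ≤ 1) :
    ∫ p, loopBias α a 0 p ^ 2 ∂(messageInnovationLaw M n) ≤ 2 := by
  have h := integral_add_innovation_sq hM (0 : Fin (n + 1)) (memLp_messagePoint (n := n) hM)
    (fun _ _ _ _ => rfl) (-a) α
  have h1 := integral_messagePoint_sq_le (n := n) hM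
  have h2 : α ^ 2 ≤ 1 := (sq_le_one_iff_abs_le_one α).2 hα
  have h3 : (-a) ^ 2 ≤ 1 := by
    rw [neg_sq]
    exact (sq_le_one_iff_abs_le_one a).2 ha
  have h4 : ∫ p, loopBias α a 0 p ^ 2 ∂(messageInnovationLaw M n) = _ := h
  have h5 : 0 ≤ ∫ p, ((p.1 : ℝ) / M) ^ 2 ∂(messageInnovationLaw M n) :=
    integral_nonneg fun _ => sq_nonneg _
  rw [h4]
  nlinarith

lemma integral_loopBias_succ (hM : 0 < M) (α a : ℝ) {k : ℕ} (hk : k < n) :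
    ∫ p, loopBias α a (k + 1) p ^ 2 ∂(messageInnovationLaw M n)
      = a ^ 2 * ∫ p, loopBias α a k p ^ 2 ∂(messageInnovationLaw M n) + (α - a) ^ 2 := by
  have h := integral_add_innovation_sq hM (⟨k + 1, by omega⟩ : Fin (n + 1))
    (memLp_loopBias (n := n) hM α a k) (fun w u u' h => loopBias_congr α a k w fun j hj =>
      h j fun hjk => by rw [hjk] at hj; simp at hj) (-a) (α - a)
  rw [neg_sq] at h
  rw [← h]
  refine integral_congr_ae (Eventually.of_forall fun p => ?_)
  simp only [loopBias_succ]
  rw [innovation_eq (by omega)]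

/-- `U_{k+1}` is orthogonal to the earlier state and bias, which Young's inequality with parameter
`η` separates. The factor `1 + 1 / η` is affordable because the bias variance will average to order
`η²`. -/
lemma integral_loopState_succ_le (hM : 0 < M) (α a : ℝ) {s x η : ℝ} (hs : s ^ 2 = 1) (hη : 0 < η)
    {k : ℕ} (hk : k < n) :
    ∫ p, loopState α a s x (k + 1) p ^ 2 ∂(messageInnovationLaw M n)
      ≤ (1 - x ^ 2) ^ 2
        + (1 + η) * x ^ 2 * ∫ p, loopState α a s x k p ^ 2 ∂(messageInnovationLaw M n)
        + (1 + 1 / η) * (1 - x ^ 2) ^ 2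
          * ∫ p, loopBias α a k p ^ 2 ∂(messageInnovationLaw M n) := by
  have hS := memLp_loopState (n := n) hM α a s x k
  have hB := memLp_loopBias (n := n) hM α a k
  have hf : MemLp (fun p : Fin M × (Fin (n + 1) → ℝ) => -(s * x) * loopState α a s x k p
      + (1 - x ^ 2) * loopBias α a k p) 2 (messageInnovationLaw M n) :=
    (hS.const_mul _).add (hB.const_mul _)
  have h := integral_add_innovation_sq hM (⟨k + 1, by omega⟩ : Fin (n + 1)) hf
    (fun w u u' h => by
      have h' : ∀ j : Fin (n + 1), (j : ℕ) ≤ k → u j = u' j := fun j hj =>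
        h j fun hjk => by rw [hjk] at hj; simp at hj
      rw [loopState_congr α a s x k w h', loopBias_congr α a k w h']) 1 (1 - x ^ 2)
  have h1 : ∫ p, loopState α a s x (k + 1) p ^ 2 ∂(messageInnovationLaw M n)
      = ∫ p : Fin M × (Fin (n + 1) → ℝ), (1 * (-(s * x) * loopState α a s x k p
        + (1 - x ^ 2) * loopBias α a k p) + (1 - x ^ 2) * p.2 ⟨k + 1, by omega⟩) ^ 2
        ∂(messageInnovationLaw M n) := by
    refine integral_congr_ae (Eventually.of_forall fun p => ?_)
    simp only [loopState_succ]
    rw [innovation_eq (by omega)]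
    ring
  have hi1 := hS.integrable_sq.const_mul ((1 + η) * x ^ 2)
  have hi2 := hB.integrable_sq.const_mul ((1 + 1 / η) * (1 - x ^ 2) ^ 2)
  have h2 := integral_mono hf.integrable_sq (hi1.add hi2) fun p => ?_
  · rw [integral_add' hi1 hi2, integral_const_mul, integral_const_mul] at h2
    rw [h1, h]
    linarith
  · simp only [Pi.add_apply]
    set S := loopState α a s x k p
    set B := loopBias α a k p
    have hid : (1 + η) * x ^ 2 * S ^ 2 + (1 + 1 / η) * (1 - x ^ 2) ^ 2 * B ^ 2
        - (-(s * x) * S + (1 - x ^ 2) * B) ^ 2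
        = (η * (s * x) * S + (1 - x ^ 2) * B) ^ 2 / η + (1 - s ^ 2) * (1 + η) * x ^ 2 * S ^ 2 := by
      field_simp
      ring
    have : 0 ≤ (η * (s * x) * S + (1 - x ^ 2) * B) ^ 2 / η := by positivity
    rw [hs] at hid
    linarith

end ClosedLoop

/-- Sums of sequences that satisfy a contracting affine recursion. -/
lemma sum_add_le_of_recursion {A : ℕ → ℝ} {f : ℕ → ℝ} {ρ : ℝ} (n : ℕ)
    (h : ∀ k < n, A (k + 1) ≤ ρ * A k + f k) :
    (1 - ρ) * ∑ k ∈ Finset.range n, A k + A n ≤ A 0 + ∑ k ∈ Finset.range n, f k := by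
  induction n with
  | zero => simp
  | succ n ih =>
    have h1 := ih fun k hk => h k (by omega)
    have h2 := h n (by omega)
    rw [Finset.sum_range_succ, Finset.sum_range_succ, mul_add]
    linarith

/-! ### Performance of the linear code -/

lemma linearCode_satisfiesPower {M n : ℕ} (hM : 0 < M) {α a s x P : ℝ} (hx : x ≠ 0)
    (h : (s / x - a) ^ 2 * ∑ k ∈ Finset.range n,
      ∫ p : Fin M × (Fin (n + 1) → ℝ), loopState α a s x k p ^ 2 ∂(messageInnovationLaw M n)
        ≤ n * P) :
    (linearCode hM n (s / x - a) (-(s / x)) (1 - x ^ 2) (a * x ^ 2)).SatisfiesPower α P := by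
  rw [FeedbackCode.SatisfiesPower]
  refine le_trans (le_of_eq ?_) (ENNReal.ofReal_le_ofReal h)
  rw [Finset.sum_range, Finset.mul_sum, ENNReal.ofReal_sum_of_nonneg
    fun i _ => mul_nonneg (sq_nonneg _) (integral_nonneg fun _ => sq_nonneg _)]
  refine Finset.sum_congr rfl fun i _ => ?_
  rw [← integral_const_mul, ofReal_integral_eq_lintegral_ofReal
    ((memLp_loopState hM α a s x i).integrable_sq.const_mul _)
    (Eventually.of_forall fun _ => mul_nonneg (sq_nonneg _) (sq_nonneg _))]
  refine lintegral_congr fun p => ?_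
  rw [input_linearCode, linearState_output hM hx p i i.2.le, mul_pow]

/-- The estimate misses `w / M` by `x ^ n` times the modulus of the final state, so rounding is
correct when `M x ^ n |S_n| < 1/2`. Markov's inequality for `S_n²` bounds the exceptional event. -/
lemma errorProb_linearCode_le {M n : ℕ} (hM : 0 < M) {α a s x : ℝ} (hx : 0 < x)
    (hs : s ^ 2 = 1) :
    (linearCode hM n (s / x - a) (-(s / x)) (1 - x ^ 2) (a * x ^ 2)).errorProb α
      ≤ 4 * (M * x ^ n) ^ 2 * ∫ p : Fin M × (Fin (n + 1) → ℝ), loopState α a s x n p ^ 2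
        ∂(messageInnovationLaw M n) := by
  have := isProbabilityMeasure_messageInnovationLaw (n := n) hM
  have hM' : (0 : ℝ) < M := by exact_mod_cast hM
  set c := linearCode hM n (s / x - a) (-(s / x)) (1 - x ^ 2) (a * x ^ 2) with hc
  set t := (4 * (M * x ^ n) ^ 2)⁻¹ with ht
  have ht0 : 0 < t := by positivity
  have hsub : {p : Fin M × (Fin (n + 1) → ℝ) | c.dec (c.output p.1 (ma1Noise α p.2)) ≠ p.1}
      ⊆ {p | t ≤ loopState α a s x n p ^ 2} := by
    intro p hp
    by_contra hlt
    simp only [Set.mem_ofPred_eq, not_le] at hlt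
    refine hp (nearestMessage_eq hM ?_)
    have h1 := linearState_output hM (α := α) (a := a) (s := s) hx.ne' p n le_rfl
    rw [linearState_eq_pow_mul_add] at h1
    set q := linearState (-(s / x)) (1 - x ^ 2) (a * x ^ 2) 0
      (extendZero (c.output p.1 (ma1Noise α p.2))) n
    have hl : -(s / x) ≠ 0 := by
      have : s ≠ 0 := by
        rintro rfl
        norm_num at hs
      exact neg_ne_zero.2 (div_ne_zero this hx.ne')
    have hln : (-(s / x)) ^ n ≠ 0 := pow_ne_zero n hl
    have h2 : M * (-q / (-(s / x)) ^ n) - ((p.1 : ℕ) : ℝ)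
        = -(M * (loopState α a s x n p / (-(s / x)) ^ n)) := by
      rw [← h1]
      field_simp
      ring
    have habs : |(-(s / x)) ^ n| = (x ^ n)⁻¹ := by
      have hs1 : |s| = 1 := by
        rw [← Real.sqrt_sq_eq_abs, hs, Real.sqrt_one]
      rw [abs_pow, abs_neg, abs_div, hs1, abs_of_pos hx, one_div, inv_pow]
    rw [h2, abs_neg, abs_mul, abs_div, habs, abs_of_pos hM']
    refine lt_of_pow_lt_pow_left₀ 2 (by norm_num) ?_
    have h3 : (M * (|loopState α a s x n p| / (x ^ n)⁻¹)) ^ 2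
        = (M * x ^ n) ^ 2 * loopState α a s x n p ^ 2 := by
      rw [← sq_abs (loopState α a s x n p)]
      field_simp
    rw [h3]
    calc (M * x ^ n) ^ 2 * loopState α a s x n p ^ 2 < (M * x ^ n) ^ 2 * t :=
          mul_lt_mul_of_pos_left hlt (by positivity)
      _ = (1 / 2) ^ 2 := by
          rw [ht]
          field_simp
          norm_num
  have h1 : c.errorProb α ≤ (messageInnovationLaw M n).real {p | t ≤ loopState α a s x n p ^ 2} :=
    measureReal_mono hsub
  have h2 := mul_meas_ge_le_integral_of_nonneg (μ := messageInnovationLaw M n)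
    (Eventually.of_forall fun p => sq_nonneg (loopState α a s x n p))
    (memLp_loopState (n := n) hM α a s x n).integrable_sq t
  have h3 : 4 * (M * x ^ n) ^ 2 = t⁻¹ := by rw [ht, inv_inv]
  rw [h3, inv_mul_eq_div, le_div_iff₀ ht0]
  nlinarith

/-- Summing the bias recursion bounds the total bias variance by a constant plus `n η²`; this is fed
into the summed state recursion. On the left, the sum governs the power and the last term the error
probability. -/
lemma loopState_bounds {M n : ℕ} (hM : 0 < M) {α a s x η : ℝ} (hα : |α| ≤ 1) (ha : |a| < 1)
    (hs : s ^ 2 = 1) (hη : 0 < η) (hbias : (α - a) ^ 2 ≤ η ^ 2 * (1 - a ^ 2)) :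
    (1 - (1 + η) * x ^ 2) * ∑ k ∈ Finset.range n,
      ∫ p : Fin M × (Fin (n + 1) → ℝ), loopState α a s x k p ^ 2 ∂(messageInnovationLaw M n)
      + ∫ p : Fin M × (Fin (n + 1) → ℝ), loopState α a s x n p ^ 2 ∂(messageInnovationLaw M n)
      ≤ 1 + (1 + 1 / η) * (1 - x ^ 2) ^ 2 * (2 / (1 - a ^ 2))
        + n * ((1 - x ^ 2) ^ 2 * (1 + η + η ^ 2)) := by
  set A : ℕ → ℝ := fun k => ∫ p : Fin M × (Fin (n + 1) → ℝ), loopState α a s x k p ^ 2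
    ∂(messageInnovationLaw M n)
  set B : ℕ → ℝ := fun k => ∫ p : Fin M × (Fin (n + 1) → ℝ), loopBias α a k p ^ 2
    ∂(messageInnovationLaw M n) with hB
  have ha2 : 0 < 1 - a ^ 2 := by
    have := (sq_lt_one_iff_abs_lt_one a).2 ha
    linarith
  have hB0 : B 0 ≤ 2 := integral_loopBias_zero_le hM hα ha.le
  have hBn : 0 ≤ B n := integral_nonneg fun _ => sq_nonneg _
  have hA0 : A 0 ≤ 1 := integral_messagePoint_sq_le hM
  have h1 := sum_add_le_of_recursion (A := B) (f := fun _ => (α - a) ^ 2) (ρ := a ^ 2) n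
    fun k hk => (integral_loopBias_succ hM α a hk).le
  have h2 := sum_add_le_of_recursion (A := A)
    (f := fun k => (1 - x ^ 2) ^ 2 + (1 + 1 / η) * (1 - x ^ 2) ^ 2 * B k)
    (ρ := (1 + η) * x ^ 2) n fun k hk => by
      have := integral_loopState_succ_le (x := x) hM α a hs hη hk
      simp only [A, B]
      linarith
  simp only [Finset.sum_add_distrib, Finset.sum_const, Finset.card_range, nsmul_eq_mul,
    ← Finset.mul_sum] at h1 h2
  have h3 : ∑ k ∈ Finset.range n, B k ≤ 2 / (1 - a ^ 2) + n * η ^ 2 := by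
    have h4 : (1 - a ^ 2) * ∑ k ∈ Finset.range n, B k
        ≤ (1 - a ^ 2) * (2 / (1 - a ^ 2) + n * η ^ 2) := by
      have h5 : (1 - a ^ 2) * (2 / (1 - a ^ 2) + n * η ^ 2)
          = 2 + n * (η ^ 2 * (1 - a ^ 2)) := by
        field_simp
      have h6 : (n : ℝ) * (α - a) ^ 2 ≤ n * (η ^ 2 * (1 - a ^ 2)) :=
        mul_le_mul_of_nonneg_left hbias (by positivity)
      rw [h5]
      linarith
    exact le_of_mul_le_mul_left h4 ha2
  have h7 : (1 + 1 / η) * (1 - x ^ 2) ^ 2 * ∑ k ∈ Finset.range n, B k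
      ≤ (1 + 1 / η) * (1 - x ^ 2) ^ 2 * (2 / (1 - a ^ 2) + n * η ^ 2) :=
    mul_le_mul_of_nonneg_left h3 (by positivity)
  have h8 : (1 + 1 / η) * (1 - x ^ 2) ^ 2 * (2 / (1 - a ^ 2) + n * η ^ 2)
      = (1 + 1 / η) * (1 - x ^ 2) ^ 2 * (2 / (1 - a ^ 2))
        + n * ((1 - x ^ 2) ^ 2 * (η + η ^ 2)) := by
    field_simp
    ring
  linarith

/-! ### Achievability -/

/-- At `η = 0` the last inequality is `hP` times `1 - x²`; continuity gives a small positive `η`. -/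
lemma exists_slack {β x P : ℝ} (hx : x ^ 2 < 1)
    (hP : (1 / x - β) ^ 2 * (1 - x ^ 2) < P) :
    ∃ η : ℝ, 0 < η ∧ η < 1 ∧ (1 + η) * x ^ 2 < 1 ∧
      (1 / x - β * (1 - η ^ 2)) ^ 2 * ((1 - x ^ 2) ^ 2 * (1 + η + η ^ 2))
        < P * (1 - (1 + η) * x ^ 2) := by
  have h1 : ∀ᶠ η : ℝ in 𝓝 0, (1 + η) * x ^ 2 < 1 := by
    have hc : ContinuousAt (fun η : ℝ => (1 + η) * x ^ 2) 0 := by fun_prop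
    exact hc.eventually_lt_const (by simpa using hx)
  have h2 : ∀ᶠ η : ℝ in 𝓝 0,
      (1 / x - β * (1 - η ^ 2)) ^ 2 * ((1 - x ^ 2) ^ 2 * (1 + η + η ^ 2))
        < P * (1 - (1 + η) * x ^ 2) := by
    have hc1 : ContinuousAt (fun η : ℝ =>
      (1 / x - β * (1 - η ^ 2)) ^ 2 * ((1 - x ^ 2) ^ 2 * (1 + η + η ^ 2))) 0 := by fun_prop
    have hc2 : ContinuousAt (fun η : ℝ => P * (1 - (1 + η) * x ^ 2)) 0 := by fun_prop
    refine hc1.eventually_lt hc2 ?_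
    have : (1 / x - β) ^ 2 * (1 - x ^ 2) * (1 - x ^ 2) < P * (1 - x ^ 2) :=
      mul_lt_mul_of_pos_right hP (by linarith)
    norm_num at this ⊢
    linarith
  have h3 : ∀ᶠ η : ℝ in 𝓝[>] 0, 0 < η := eventually_mem_nhdsWithin
  have h4 : ∀ᶠ η : ℝ in 𝓝 0, η < 1 := eventually_lt_nhds one_pos
  obtain ⟨η, ha, hb, hc, hd⟩ := (h3.and ((h4.and (h1.and h2)).filter_mono
    nhdsWithin_le_nhds)).exists
  exact ⟨η, ha, hb, hc, hd⟩

lemma exists_code_errorProb_le {α P x : ℝ} (hα : |α| ≤ 1) (hx : 0 < x) (hx1 : x < 1)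
    (hP : (1 / x - |α|) ^ 2 * (1 - x ^ 2) < P) :
    ∃ K : ℝ, ∃ N : ℕ, ∀ n, N ≤ n → ∀ M : ℕ, 0 < M → ∃ c : FeedbackCode M n,
      c.SatisfiesPower α P ∧ c.errorProb α ≤ K * ((n + 1) * (M * x ^ n) ^ 2) := by
  have hx2 : x ^ 2 < 1 := by nlinarith
  obtain ⟨η, hη, hη1, hρ, hG⟩ := exists_slack hx2 hP
  -- `s` is a sign of `α`, so that the gain `s / x - a` has modulus close to `1 / x - |α|` and not
  -- to `1 / x + |α|`.
  obtain ⟨s, hs, hsα⟩ : ∃ s : ℝ, s ^ 2 = 1 ∧ s * α = |α| := by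
    rcases abs_cases α with ⟨h, _⟩ | ⟨h, _⟩
    · exact ⟨1, by norm_num, by rw [h, one_mul]⟩
    · exact ⟨-1, by norm_num, by rw [h, neg_one_mul]⟩
  -- With `a = α` and `|α| = 1` the bias would never decay. The shrinkage costs a stationary bias
  -- variance `(α - a)² / (1 - a²)` of at most `η²`.
  set a := α * (1 - η ^ 2) with ha
  have hη2 : 0 < η ^ 2 ∧ η ^ 2 < 1 := ⟨by positivity, by nlinarith⟩
  have haα : |a| < 1 := by
    rw [ha, abs_mul, abs_of_pos (by linarith : (0 : ℝ) < 1 - η ^ 2)]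
    nlinarith [abs_nonneg α]
  have hα2 : α ^ 2 ≤ 1 := (sq_le_one_iff_abs_le_one α).2 hα
  have hbias : (α - a) ^ 2 ≤ η ^ 2 * (1 - a ^ 2) := by
    have h1 : η ^ 2 * (1 - a ^ 2) - (α - a) ^ 2
        = η ^ 2 * (1 - α ^ 2 * (1 - η ^ 2 * (1 - η ^ 2))) := by
      rw [ha]
      ring
    have h2 : 0 ≤ η ^ 2 * (1 - η ^ 2) := mul_nonneg hη2.1.le (by linarith)
    have h3 : α ^ 2 * (1 - η ^ 2 * (1 - η ^ 2)) ≤ 1 := by nlinarith [sq_nonneg α]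
    have h4 : 0 ≤ η ^ 2 * (1 - α ^ 2 * (1 - η ^ 2 * (1 - η ^ 2))) :=
      mul_nonneg hη2.1.le (by linarith)
    linarith
  have hg : (s / x - a) ^ 2 = (1 / x - |α| * (1 - η ^ 2)) ^ 2 := by
    have h1 : s * (s / x - a) = 1 / x - |α| * (1 - η ^ 2) := by
      rw [← hsα, ha, ← hs]
      ring
    rw [← h1, mul_pow, hs, one_mul]
  rw [← hg] at hG
  set ρ := (1 + η) * x ^ 2
  set K₁ := 1 + (1 + 1 / η) * (1 - x ^ 2) ^ 2 * (2 / (1 - a ^ 2)) with hK₁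
  set K₂ := (1 - x ^ 2) ^ 2 * (1 + η + η ^ 2) with hK₂
  have ha2 : 0 < 1 - a ^ 2 := by
    have := (sq_lt_one_iff_abs_lt_one a).2 haα
    linarith
  have hK₁0 : 0 ≤ K₁ := by positivity
  have hK₂0 : 0 ≤ K₂ := by positivity
  have hgap : 0 < P * (1 - ρ) - (s / x - a) ^ 2 * K₂ := by linarith
  obtain ⟨N, hN⟩ := exists_nat_ge ((s / x - a) ^ 2 * K₁ / (P * (1 - ρ) - (s / x - a) ^ 2 * K₂))
  refine ⟨4 * (K₁ + K₂), N, fun n hn M hM => ⟨_, linearCode_satisfiesPower (a := a) (s := s) hM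
    hx.ne' ?_, (errorProb_linearCode_le hM hx hs).trans ?_⟩⟩
  · have hb := loopState_bounds (n := n) (x := x) hM hα haα hs hη hbias
    set A := ∑ k ∈ Finset.range n, ∫ p : Fin M × (Fin (n + 1) → ℝ), loopState α a s x k p ^ 2
      ∂(messageInnovationLaw M n)
    have h0 : 0 ≤ ∫ p : Fin M × (Fin (n + 1) → ℝ), loopState α a s x n p ^ 2
      ∂(messageInnovationLaw M n) := integral_nonneg fun _ => sq_nonneg _
    have h1 : (1 - ρ) * A ≤ K₁ + n * K₂ := by linarith
    have h2 := mul_le_mul_of_nonneg_left h1 (sq_nonneg (s / x - a))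
    have h3 : (s / x - a) ^ 2 * K₁ ≤ n * (P * (1 - ρ) - (s / x - a) ^ 2 * K₂) := by
      rw [← div_le_iff₀ hgap]
      exact hN.trans (by exact_mod_cast hn)
    have h4 : (1 - ρ) * ((s / x - a) ^ 2 * A) ≤ (1 - ρ) * (n * P) := by linarith
    exact le_of_mul_le_mul_left h4 (by linarith)
  · have hb := loopState_bounds (n := n) (x := x) hM hα haα hs hη hbias
    have h0 : 0 ≤ ∑ k ∈ Finset.range n, ∫ p : Fin M × (Fin (n + 1) → ℝ),
        loopState α a s x k p ^ 2 ∂(messageInnovationLaw M n) :=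
      Finset.sum_nonneg fun _ _ => integral_nonneg fun _ => sq_nonneg _
    have h1 := mul_nonneg (by linarith : 0 ≤ 1 - ρ) h0
    have h2 : ∫ p : Fin M × (Fin (n + 1) → ℝ), loopState α a s x n p ^ 2
        ∂(messageInnovationLaw M n) ≤ (K₁ + K₂) * (n + 1) := by
      have : 0 ≤ (n : ℝ) * K₁ := by positivity
      linarith
    calc 4 * (M * x ^ n) ^ 2 * ∫ p : Fin M × (Fin (n + 1) → ℝ), loopState α a s x n p ^ 2
          ∂(messageInnovationLaw M n)
        ≤ 4 * (M * x ^ n) ^ 2 * ((K₁ + K₂) * (n + 1)) :=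
          mul_le_mul_of_nonneg_left h2 (by positivity)
      _ = 4 * (K₁ + K₂) * ((n + 1) * (M * x ^ n) ^ 2) := by ring

/-- Below the capacity, there are codes with vanishing error probability. -/
lemma exists_code_tendsto_zero {α P x₀ ε : ℝ} (hα : |α| ≤ 1) (hx : 0 < x₀) (hx1 : x₀ < 1)
    (hroot : P * x₀ ^ 2 = (1 - x₀ ^ 2) * (1 - |α| * x₀) ^ 2) (hε : 0 < ε) :
    ∃ b : ℕ → ℝ, Tendsto b atTop (𝓝 0) ∧ ∃ N : ℕ, ∀ n, N ≤ n → ∀ M : ℕ, 0 < M →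
      (M : ℝ) ≤ 2 ^ ((n : ℝ) * (-Real.logb 2 x₀ - ε)) + 1 →
        ∃ c : FeedbackCode M n, c.SatisfiesPower α P ∧ c.errorProb α ≤ b n := by
  have h2ε : 1 < (2 : ℝ) ^ ε := Real.one_lt_rpow one_lt_two hε
  -- `(1/x - |α|)² (1 - x²)` equals `P` at `x₀` and decreases, so `x > x₀` leaves spare power, while
  -- `x < x₀ 2^ε` keeps the rate achievable.
  obtain ⟨x, hxl, hxr⟩ : ∃ x, x₀ < x ∧ x < min 1 (x₀ * 2 ^ ε) :=
    exists_between (lt_min hx1 (by nlinarith))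
  have hx0 : 0 < x := hx.trans hxl
  have hxlt1 : x < 1 := hxr.trans_le (min_le_left _ _)
  have hxε : x < x₀ * 2 ^ ε := hxr.trans_le (min_le_right _ _)
  have hP : (1 / x - |α|) ^ 2 * (1 - x ^ 2) < P := by
    have h1 : P = (1 / x₀ - |α|) ^ 2 * (1 - x₀ ^ 2) := by
      field_simp
      linarith
    have h2 : 1 / x < 1 / x₀ := one_div_lt_one_div_of_lt hx hxl
    have h3 : 1 < 1 / x := by rwa [lt_div_iff₀ hx0, one_mul]
    rw [h1]
    refine mul_lt_mul'' ?_ ?_ (sq_nonneg _) (by nlinarith)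
    · exact pow_lt_pow_left₀ (by linarith) (by linarith) two_ne_zero
    · nlinarith
  obtain ⟨K, N, hK⟩ := exists_code_errorProb_le hα hx0 hxlt1 hP
  set r := (2 : ℝ) ^ (-Real.logb 2 x₀ - ε) with hr
  have hr0 : 0 < r := by positivity
  have hrx : r * x < 1 := by
    have h1 : r = x₀⁻¹ * (2 ^ ε)⁻¹ := by
      rw [hr, sub_eq_add_neg, Real.rpow_add two_pos, Real.rpow_neg two_pos.le,
        Real.rpow_neg two_pos.le, Real.rpow_logb two_pos (by norm_num) hx]
    rw [h1, ← mul_inv, inv_mul_lt_one₀ (by positivity)]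
    exact hxε
  -- The second entry absorbs the `+ 1` that comes from rounding up the number of messages.
  set y := max (r * x) x with hy
  have hy0 : 0 ≤ y := hx0.le.trans (le_max_right _ _)
  have hy1 : y < 1 := max_lt hrx hxlt1
  have hz0 : 0 ≤ y ^ 2 := sq_nonneg y
  have hz1 : y ^ 2 < 1 := by nlinarith
  refine ⟨fun n => |K| * (4 * ((n + 1) * (y ^ 2) ^ n)), ?_, N, fun n hn M hM hMn => ?_⟩
  · have h1 := tendsto_self_mul_const_pow_of_lt_one hz0 hz1
    have h2 := tendsto_pow_atTop_nhds_zero_of_lt_one hz0 hz1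
    have h3 := (((h1.add h2).const_mul 4).const_mul |K|)
    simp only [add_zero, mul_zero] at h3
    refine h3.congr fun n => ?_
    ring
  · obtain ⟨c, hc, he⟩ := hK n hn M hM
    refine ⟨c, hc, he.trans ?_⟩
    have hMx : M * x ^ n ≤ 2 * y ^ n := by
      have h1 : (2 : ℝ) ^ ((n : ℝ) * (-Real.logb 2 x₀ - ε)) = r ^ n := by
        rw [mul_comm, Real.rpow_mul_natCast two_pos.le]
      rw [h1] at hMn
      have h2 : M * x ^ n ≤ (r ^ n + 1) * x ^ n :=
        mul_le_mul_of_nonneg_right hMn (by positivity)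
      have h3 : (r * x) ^ n ≤ y ^ n := pow_le_pow_left₀ (by positivity) (le_max_left _ _) n
      have h4 : x ^ n ≤ y ^ n := pow_le_pow_left₀ hx0.le (le_max_right _ _) n
      rw [mul_pow] at h3
      linarith
    have h5 : (M * x ^ n) ^ 2 ≤ 4 * (y ^ 2) ^ n := by
      calc (M * x ^ n) ^ 2 ≤ (2 * y ^ n) ^ 2 := pow_le_pow_left₀ (by positivity) hMx 2
        _ = 4 * (y ^ 2) ^ n := by
          rw [mul_pow, ← pow_mul, ← pow_mul, mul_comm n 2]
          norm_num
    calc K * ((n + 1) * (M * x ^ n) ^ 2) ≤ |K| * ((n + 1) * (M * x ^ n) ^ 2) :=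
          mul_le_mul_of_nonneg_right (le_abs_self K) (by positivity)
      _ ≤ |K| * ((n + 1) * (4 * (y ^ 2) ^ n)) := by gcongr
      _ = |K| * (4 * ((n + 1) * (y ^ 2) ^ n)) := by ring

/-- The silent code fills the block lengths at which nothing is claimed about errors, since a
sequence of codes must be defined at every length. -/
lemma exists_code_satisfiesPower {M : ℕ} (hM : 0 < M) (n : ℕ) (α P : ℝ) :
    ∃ c : FeedbackCode M n, c.SatisfiesPower α P := by
  refine ⟨linearCode hM n 0 0 0 0, ?_⟩
  rw [FeedbackCode.SatisfiesPower]
  simp [input_linearCode]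

/-! ### The capacity -/

lemma numMessages_pos (n : ℕ) (R : ℝ) : 0 < numMessages n R :=
  Nat.ceil_pos.2 (by positivity)

lemma le_numMessages (n : ℕ) (R : ℝ) : (2 : ℝ) ^ ((n : ℝ) * R) ≤ numMessages n R :=
  Nat.le_ceil _

lemma numMessages_le (n : ℕ) (R : ℝ) : (numMessages n R : ℝ) ≤ 2 ^ ((n : ℝ) * R) + 1 :=
  (Nat.ceil_lt_add_one (by positivity)).le

lemma rpow_mul_mono (n : ℕ) {R R' : ℝ} (h : R ≤ R') :
    (2 : ℝ) ^ ((n : ℝ) * R) ≤ 2 ^ ((n : ℝ) * R') :=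
  Real.rpow_le_rpow_of_exponent_le one_le_two (mul_le_mul_of_nonneg_left h (by positivity))

lemma exists_pos_forall_le {f : ℕ → ℝ} (hf : ∀ n, 1 ≤ n → 0 < f n) (N : ℕ) :
    ∃ δ : ℝ, 0 < δ ∧ ∀ n, 1 ≤ n → n < N → δ ≤ f n := by
  induction N with
  | zero => exact ⟨1, one_pos, fun n _ h => absurd h (by omega)⟩
  | succ N ih =>
    obtain ⟨δ, hδ, h⟩ := ih
    rcases Nat.eq_zero_or_pos N with rfl | hN
    · exact ⟨δ, hδ, fun n h1 h2 => absurd h1 (by omega)⟩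
    · refine ⟨min δ (f N), lt_min hδ (hf N hN), fun n h1 h2 => ?_⟩
      rcases Nat.lt_succ_iff_lt_or_eq.1 h2 with h3 | rfl
      · exact (min_le_left _ _).trans (h n h1 h3)
      · exact min_le_right _ _

theorem isFeedbackCapacity_of_root {α P x : ℝ} (hα : |α| ≤ 1) (hP : 0 ≤ P) (hx : 0 < x)
    (hx1 : x < 1) (hroot : P * x ^ 2 = (1 - x ^ 2) * (1 - |α| * x) ^ 2) :
    IsFeedbackCapacity α P (-Real.logb 2 x) := by
  set C := -Real.logb 2 x with hC
  have hCpos : 0 < C := by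
    rw [hC, neg_pos]
    exact Real.logb_neg one_lt_two hx hx1
  refine ⟨⟨fun _ => C, fun ε hε => ?_, fun ε hε c hc => ?_⟩, fun S hS => ?_⟩
  · obtain ⟨b, hb, N, h⟩ := exists_code_tendsto_zero hα hx hx1 hroot hε
    have hex : ∀ n, ∃ c : FeedbackCode (numMessages n (C - ε)) n,
        c.SatisfiesPower α P ∧ (N ≤ n → c.errorProb α ≤ b n) := by
      intro n
      by_cases hn : N ≤ n
      · obtain ⟨c, h1, h2⟩ := h n hn _ (numMessages_pos n _) (numMessages_le n (C - ε))
        exact ⟨c, h1, fun _ => h2⟩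
      · obtain ⟨c, h1⟩ := exists_code_satisfiesPower (numMessages_pos n (C - ε)) n α P
        exact ⟨c, h1, fun h => absurd h hn⟩
    choose c hc1 hc2 using hex
    refine ⟨c, fun n _ => hc1 n, squeeze_zero' (Eventually.of_forall fun n =>
      (c n).errorProb_nonneg α) ?_ hb⟩
    filter_upwards [eventually_ge_atTop N] with n hn using hc2 n hn
  · obtain ⟨δ, hδ, N, h⟩ := exists_errorProb_ge hα hP hx hx1 hroot hε
    -- The asymptotic bound leaves finitely many `n ≥ 1`; each has at least two messages and so a
    -- positive error probability.
    have hpos : ∀ n, 1 ≤ n → 0 < (c n).errorProb α := by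
      intro n hn
      refine (c n).errorProb_pos α ?_
      have h1 : (1 : ℝ) < 2 ^ ((n : ℝ) * (C + ε)) := by
        have : (1 : ℝ) ≤ n := by exact_mod_cast hn
        exact Real.one_lt_rpow one_lt_two (by positivity)
      exact_mod_cast h1.trans_le (le_numMessages n (C + ε))
    obtain ⟨δ', hδ', h'⟩ := exists_pos_forall_le hpos N
    refine ⟨min δ δ', lt_min hδ hδ', fun n hn => ?_⟩
    rcases lt_or_ge n N with hnN | hnN
    · exact (min_le_right _ _).trans (h' n hn hnN)
    · exact (min_le_left _ _).trans (h n hnN _ (c n) (hc n hn) (le_numMessages n _))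
  · refine tendsto_order.2 ⟨fun r hr => ?_, fun r hr => ?_⟩
    · obtain ⟨b, hb, N, h⟩ := exists_code_tendsto_zero (ε := (C - r) / 2) hα hx hx1 hroot
        (by linarith)
      -- Where `S n ≤ r`, the rate `S n + (C - r) / 2` is at most `C - (C - r) / 2`, so good codes
      -- exist. If this happened for arbitrarily large `n`, the second clause would fail.
      have hex : ∀ n, ∃ c : FeedbackCode (numMessages n (S n + (C - r) / 2)) n,
          c.SatisfiesPower α P ∧ (N ≤ n → S n ≤ r → c.errorProb α ≤ b n) := by
        intro n
        by_cases hn : N ≤ n ∧ S n ≤ r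
        · obtain ⟨c, h1, h2⟩ := h n hn.1 _ (numMessages_pos n (S n + (C - r) / 2))
            ((numMessages_le n _).trans (add_le_add_left (rpow_mul_mono n (by linarith)) 1))
          exact ⟨c, h1, fun _ _ => h2⟩
        · obtain ⟨c, h1⟩ := exists_code_satisfiesPower
            (numMessages_pos n (S n + (C - r) / 2)) n α P
          exact ⟨c, h1, fun h h' => absurd ⟨h, h'⟩ hn⟩
      choose c hc1 hc2 using hex
      obtain ⟨δ, hδ, hc3⟩ := hS.2 ((C - r) / 2) (by linarith) c fun n _ => hc1 n
      filter_upwards [eventually_ge_atTop N, eventually_ge_atTop 1, hb.eventually_lt_const hδ]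
        with n hn hn1 hbn
      by_contra hle
      have := hc2 n hn (not_lt.1 hle)
      linarith [hc3 n hn1]
    -- Where `S n ≥ r`, the rate `S n - (r - C) / 2` is at least `C + (r - C) / 2`, so the converse
    -- keeps the error away from zero.
    · obtain ⟨c, hc1, hc2⟩ := hS.1 ((r - C) / 2) (by linarith)
      obtain ⟨δ, hδ, N, h⟩ := exists_errorProb_ge (ε := (r - C) / 2) hα hP hx hx1 hroot
        (by linarith)
      filter_upwards [eventually_ge_atTop N, eventually_ge_atTop 1, hc2.eventually_lt_const hδ]
        with n hn hn1 hcn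
      by_contra hle
      have := h n hn _ (c n) (hc1 n hn1)
        ((rpow_mul_mono n (by linarith)).trans (le_numMessages n _))
      linarith

/-! ### The positive root of the capacity equation -/

lemma lt_one_of_root {P β x : ℝ} (hP : 0 < P) (hx : 0 < x)
    (h : P * x ^ 2 = (1 - x ^ 2) * (1 - β * x) ^ 2) : x < 1 := by
  by_contra hge
  push Not at hge
  have h1 : 0 < P * x ^ 2 := by positivity
  have h2 : (1 - x ^ 2) * (1 - β * x) ^ 2 ≤ 0 :=
    mul_nonpos_of_nonpos_of_nonneg (by nlinarith) (sq_nonneg _)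
  linarith

/-- Up to `1` the left side increases strictly and the right side does not increase; `β ≤ 1` keeps
`1 - β x` nonnegative there. -/
lemma not_lt_of_roots {P β x y : ℝ} (hP : 0 < P) (hβ0 : 0 ≤ β) (hβ1 : β ≤ 1) (hx : 0 < x)
    (hxr : P * x ^ 2 = (1 - x ^ 2) * (1 - β * x) ^ 2)
    (hyr : P * y ^ 2 = (1 - y ^ 2) * (1 - β * y) ^ 2) : ¬ x < y := by
  intro hxy
  have hy := hx.trans hxy
  have hy1 := lt_one_of_root hP hy hyr
  have h1 : P * x ^ 2 < P * y ^ 2 :=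
    mul_lt_mul_of_pos_left (pow_lt_pow_left₀ hxy hx.le two_ne_zero) hP
  have h2 : (1 - y ^ 2) * (1 - β * y) ^ 2 ≤ (1 - x ^ 2) * (1 - β * x) ^ 2 := by
    refine mul_le_mul (by nlinarith) (pow_le_pow_left₀ (by nlinarith) (by nlinarith) 2)
      (sq_nonneg _) (by nlinarith)
  linarith

lemma exists_root {P : ℝ} (β : ℝ) (hP : 0 < P) :
    ∃ x : ℝ, 0 < x ∧ P * x ^ 2 = (1 - x ^ 2) * (1 - β * x) ^ 2 := by
  have hc : ContinuousOn (fun x : ℝ => P * x ^ 2 - (1 - x ^ 2) * (1 - β * x) ^ 2)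
      (Set.Icc 0 1) := by fun_prop
  obtain ⟨x, hx, h⟩ := intermediate_value_Icc zero_le_one hc
    (show (0 : ℝ) ∈ Set.Icc _ _ by constructor <;> norm_num [hP.le])
  simp only at h
  refine ⟨x, lt_of_le_of_ne hx.1 ?_, by linarith⟩
  rintro rfl
  norm_num at h

end GaussianFeedback

end

theorem theorem1 (α P : ℝ) (hα : |α| ≤ 1) (hP : 0 < P) :
    ∃ x₀ : ℝ,
      (0 < x₀ ∧ P * x₀ ^ 2 = (1 - x₀ ^ 2) * (1 - |α| * x₀) ^ 2) ∧
      (∀ x : ℝ, 0 < x → P * x ^ 2 = (1 - x ^ 2) * (1 - |α| * x) ^ 2 → x = x₀) ∧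
      GaussianFeedback.IsFeedbackCapacity α P (-Real.logb 2 x₀) := by
  obtain ⟨x₀, hx₀, hroot⟩ := GaussianFeedback.exists_root |α| hP
  refine ⟨x₀, ⟨hx₀, hroot⟩, fun x hx hxr => ?_, ?_⟩
  · exact le_antisymm
      (not_lt.1 (GaussianFeedback.not_lt_of_roots hP (abs_nonneg α) hα hx₀ hroot hxr))
      (not_lt.1 (GaussianFeedback.not_lt_of_roots hP (abs_nonneg α) hα hx hxr hroot))
  · exact GaussianFeedback.isFeedbackCapacity_of_root hα hP.le hx₀
      (GaussianFeedback.lt_one_of_root hP hx₀ hroot) hroot
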